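/- Let $0<\alpha<\pi/2$ and $S_\alpha=\{z\in\mathbb C:\operatorname{Re}z>0,\ |\arg z|<\alpha\}$. Let $\mu$ be a complex Borel measure supported on a compact subset of $S_\alpha$ with $\int_{S_\alpha}d\mu=0$, let $F(z)=\int_{S_\alpha}e^{-z\xi}\,d\mu(\xi)$ ($z\in\mathbb C$) be its Fourier--Borel transform, and let $\widetilde F(z)=\overline{F(\overline z)}$, which is the Fourier--Borel transform of the measure $\widetilde\mu(S)=\overline{\mu(\overline S)}$. Let $(T(t))_{t\in S_\alpha}=(\exp(tA))_{t\in S_\alpha}$ be an analytic semigroup of bounded operators on a complex Banach space $\mathcal X$, that is, $T:S_\alpha\to\mathcal B(\mathcal X)$ is analytic and $T(s+t)=T(s)T(t)$ for all $s,t\in S_\alpha$. Suppose that the semigroup is not quasinilpotent, i.e. that not all $T(t)$ have spectral radius $0$. For $t>0$ put $$F(-tA)=\int_{S_\alpha}T(t\xi)\,d\mu(\xi),\qquad \widetilde F(-tA)=\int_{S_\alpha}T(t\xi)\,d\widetilde\mu(\xi).$$ Let $\mathcal A_T$ be the closed (not necessarily unital) subalgebra of $\mathcal B(\mathcal X)$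 generated by $(T(t))_{t\in S_\alpha}$, $\operatorname{rad}\mathcal A_T$ its Jacobson radical, and $\pi:\mathcal A_T\to\mathcal A_T/\operatorname{rad}\mathcal A_T$ the canonical surjection. Let $\rho$ denote the spectral radius. If there exists $t_0>0$ such that $$\rho\bigl(F(-tA)\widetilde F(-tA)\bigr)<\sup_{x>0}|F(x)|^2\qquad\text{for all }0<t\le t_0,$$ then the algebra $\mathcal A_T/\operatorname{rad}\mathcal A_T$ is unital and the generator of the semigroup $\pi(T(t))_{t\in S_\alpha}$, acting by multiplication on $\mathcal A_T/\operatorname{rad}\mathcal A_T$, is bounded (and everywhere defined). -/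

import Mathlib

open MeasureTheory Filter Topology
open scoped ComplexConjugate ENNReal

noncomputable section

namespace SectorSemigroup

/-! ### The radical of a Banach algebra without unit, and the quotient by it -/

section Radical

variable (A : Type*) [NonUnitalNormedRing A] [NormedSpace ℂ A] [IsScalarTower ℂ A A]
  [SMulCommClass ℂ A A]

/-- The Jacobson radical of a complex algebra `A`, which need not have a unit: the part lying
in `A` of the Jacobson radical (intersection of the maximal left ideals) of the
algebra `A ⊕ ℂ1` obtained by adjoining a unit. -/
def radical : Submodule ℂ A where
  carrier := {x | (x : Unitization ℂ A) ∈ Ring.jacobson (Unitization ℂ A)}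
  add_mem' := fun {x y} hx hy => by
    rw [Set.mem_ofPred_eq, Unitization.inr_add]
    exact add_mem hx hy
  zero_mem' := by
    rw [Set.mem_ofPred_eq, Unitization.inr_zero]
    exact zero_mem _
  smul_mem' := fun c x hx => by
    have h : ((c • x : A) : Unitization ℂ A) = Unitization.inl c * (x : Unitization ℂ A) := by
      rw [Unitization.inl_mul_inr]
    rw [Set.mem_ofPred_eq, h]
    exact Ideal.mul_mem_left _ _ hx

variable {A}

theorem mem_radical {x : A} :
    x ∈ radical A ↔ (x : Unitization ℂ A) ∈ Ring.jacobson (Unitization ℂ A) :=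
  Iff.rfl

theorem mul_mem_radical_right (x : A) {y : A} (hy : y ∈ radical A) : x * y ∈ radical A := by
  rw [mem_radical, Unitization.inr_mul]
  exact Ideal.mul_mem_left _ _ hy

theorem mul_mem_radical_left {x : A} (hx : x ∈ radical A) (y : A) : x * y ∈ radical A := by
  rw [mem_radical, Unitization.inr_mul]
  exact Ideal.mul_mem_right _ _ hx

/-- The radical of a Banach algebra is closed. -/
instance isClosed_radical [CompleteSpace A] : IsClosed (radical A : Set A) := by
  let e : WithLp 1 (Unitization ℂ A) ≃+* Unitization ℂ A :=
    (WithLp.unitizationAlgEquiv ℂ (𝕜 := ℂ) (A := A)).toRingEquiv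
  have key : (radical A : Set A) =
      ⋂ I ∈ {I : Ideal (Unitization ℂ A) | IsCoatom I},
        (fun x : A => WithLp.toLp 1 (x : Unitization ℂ A)) ⁻¹'
          ((I.comap e : Ideal (WithLp 1 (Unitization ℂ A))) : Set _) := by
    ext x
    simp only [Set.mem_iInter, SetLike.mem_coe, mem_radical, Ring.jacobson, Module.jacobson,
      Submodule.mem_sInf]
    rfl
  rw [key]
  refine isClosed_biInter fun I hI => ?_
  have hmax : (I.comap e).IsMaximal := by
    have : I.IsMaximal := ⟨hI⟩
    exact Ideal.comap_isMaximal_of_equiv e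
  exact (Ideal.IsMaximal.isClosed (hI := hmax)).preimage
    (WithLp.unitization_isometry_inr (𝕜 := ℂ) (A := A)).continuous

variable (A) in
/-- The quotient algebra `A / rad A`; it carries the quotient norm. -/
abbrev RadQuotient : Type _ := A ⧸ radical A

variable (A) in
/-- The canonical surjection `A → A / rad A`. -/
abbrev toRadQuotient : A →ₗ[ℂ] RadQuotient A := (radical A).mkQ

variable (A) in
/-- The multiplication of `A / rad A`, induced by that of `A`. -/
def radQuotientMul : RadQuotient A →ₗ[ℂ] RadQuotient A →ₗ[ℂ] RadQuotient A :=
  (radical A).liftQ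
    { toFun := fun x => (radical A).mapQ (radical A) (LinearMap.mulLeft ℂ x)
        fun _ hy => mul_mem_radical_right x hy
      map_add' := fun x y => by
        ext z
        exact congrArg (radical A).mkQ (add_mul x y z)
      map_smul' := fun c x => by
        ext z
        exact congrArg (radical A).mkQ (smul_mul_assoc c x z) }
    (fun x hx => by
      rw [LinearMap.mem_ker]
      ext z
      exact (Submodule.Quotient.mk_eq_zero (radical A)).2 (mul_mem_radical_left hx z))

instance : Mul (RadQuotient A) := ⟨fun x y => radQuotientMul A x y⟩

theorem toRadQuotient_mul (x y : A) :
    toRadQuotient A (x * y) = toRadQuotient A x * toRadQuotient A y :=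
  rfl

instance [CompleteSpace A] : NonUnitalNormedRing (RadQuotient A) :=
  { Submodule.Quotient.normedAddCommGroup (radical A) with
    mul := fun x y => radQuotientMul A x y
    left_distrib := fun x y z => map_add (radQuotientMul A x) y z
    right_distrib := fun x y z => LinearMap.map_add₂ (radQuotientMul A) x y z
    zero_mul := fun x => LinearMap.map_zero₂ (radQuotientMul A) x
    mul_zero := fun x => map_zero (radQuotientMul A x)
    mul_assoc := by
      rintro ⟨x⟩ ⟨y⟩ ⟨z⟩
      exact congrArg (toRadQuotient A) (mul_assoc x y z)
    norm_mul_le := by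
      intro x y
      refine le_of_forall_pos_le_add fun ε hε => ?_
      have : ContinuousAt (fun δ : ℝ => (‖x‖ + δ) * (‖y‖ + δ)) 0 := by fun_prop
      obtain ⟨δ, hδ, h⟩ : ∃ δ > 0, (‖x‖ + δ) * (‖y‖ + δ) < ‖x‖ * ‖y‖ + ε := by
        have h1 : ∀ᶠ δ in 𝓝[>] (0 : ℝ), (‖x‖ + δ) * (‖y‖ + δ) < ‖x‖ * ‖y‖ + ε := by
          refine (this.tendsto.mono_left nhdsWithin_le_nhds).eventually_lt_const ?_
          simpa using hε
        obtain ⟨δ, h2, h3⟩ := (h1.and self_mem_nhdsWithin).exists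
        exact ⟨δ, h3, h2⟩
      obtain ⟨a, rfl, ha⟩ := Submodule.Quotient.norm_mk_lt x hδ
      obtain ⟨b, rfl, hb⟩ := Submodule.Quotient.norm_mk_lt y hδ
      calc _ ≤ ‖a * b‖ := Submodule.Quotient.norm_mk_le (radical A) (a * b)
        _ ≤ ‖a‖ * ‖b‖ := norm_mul_le a b
        _ ≤ _ := mul_le_mul ha.le hb.le (norm_nonneg _) (by positivity)
        _ ≤ _ := h.le }

instance [CompleteSpace A] : NormedSpace ℂ (RadQuotient A) :=
  Submodule.Quotient.normedSpace (radical A) ℂ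

instance [CompleteSpace A] : CompleteSpace (RadQuotient A) :=
  Submodule.Quotient.completeSpace (radical A)

instance : SMulCommClass ℂ (RadQuotient A) (RadQuotient A) :=
  ⟨fun c x y => (map_smul (radQuotientMul A x) c y).symm⟩

instance : IsScalarTower ℂ (RadQuotient A) (RadQuotient A) :=
  ⟨fun c x y => LinearMap.map_smul₂ (radQuotientMul A) c x y⟩

end Radical

/-- An algebra is unital if it has a two-sided identity element. -/
def IsUnital (B : Type*) [Mul B] : Prop :=
  ∃ e : B, ∀ x : B, e * x = x ∧ x * e = x

/-! ### Generators -/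

section Generator

variable {B : Type*} [NormedAddCommGroup B] [NormedSpace ℂ B]

/-- The infinitesimal generator of a family `(S(t))_{t>0}` of operators on `B`: the operator
`x ↦ lim_{t → 0+} (S(t) x - x) / t`, whose domain is the set of `x` for which the limit exists. -/
def generator (S : ℝ → B →ₗ[ℂ] B) : B →ₗ.[ℂ] B where
  domain :=
    { carrier := {x | ∃ y, Tendsto (fun t : ℝ => t⁻¹ • (S t x - x)) (𝓝[>] 0) (𝓝 y)}
      add_mem' := by
        rintro x x' ⟨y, hy⟩ ⟨y', hy'⟩
        refine ⟨y + y', (hy.add hy').congr fun t => ?_⟩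
        rw [map_add, ← smul_add]
        congr 1
        abel
      zero_mem' := ⟨0, by simp⟩
      smul_mem' := by
        rintro c x ⟨y, hy⟩
        refine ⟨c • y, (hy.const_smul c).congr fun t => ?_⟩
        rw [map_smul, ← smul_sub, smul_comm] }
  toFun :=
    { toFun := fun x => x.2.choose
      map_add' := by
        intro x x'
        refine tendsto_nhds_unique (x + x').2.choose_spec
          ((x.2.choose_spec.add x'.2.choose_spec).congr fun t => ?_)
        rw [Submodule.coe_add, map_add, ← smul_add]
        congr 1
        abel
      map_smul' := by
        intro c x
        refine tendsto_nhds_unique (c • x).2.choose_spec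
          ((x.2.choose_spec.const_smul c).congr fun t => ?_)
        rw [Submodule.coe_smul, map_smul, ← smul_sub, smul_comm] }

/-- A (possibly unbounded) operator is bounded if it is defined everywhere and bounded. -/
def IsBoundedOperator (G : B →ₗ.[ℂ] B) : Prop :=
  G.domain = ⊤ ∧ ∃ C : ℝ, ∀ x : G.domain, ‖G x‖ ≤ C * ‖(x : B)‖

end Generator

/-! ### Sectors, measures and the functional calculus -/

/-- The open sector `S_α` of all `z` with `Re z > 0` and `|arg z| < α`. -/
def sector (α : ℝ) : Set ℂ := {z | 0 < z.re ∧ |z.arg| < α}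

/-- `μ` is a compactly supported measure on `U`: it vanishes outside some compact subset of `U`. -/
def IsCompactlySupportedIn (μ : ComplexMeasure ℂ) (U : Set ℂ) : Prop :=
  ∃ K : Set ℂ, IsCompact K ∧ K ⊆ U ∧ ∀ s, MeasurableSet s → Disjoint s K → μ s = 0

/-- The Bochner integral `⟨f, μ⟩ = ∫ f dμ` of a vector-valued function against a complex
measure. -/
def pairing {E : Type*} [NormedAddCommGroup E] [NormedSpace ℂ E] (f : ℂ → E)
    (μ : ComplexMeasure ℂ) : E :=
  μ.integral f (ContinuousLinearMap.lsmul ℝ ℂ).flip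

/-- The Fourier–Borel transform `F(z) = ∫ e^{-zξ} dμ(ξ)`. -/
def fourierBorel (μ : ComplexMeasure ℂ) (z : ℂ) : ℂ :=
  pairing (fun ξ => Complex.exp (-z * ξ)) μ

/-- The reflected measure `μ̃(S) = conj (μ (conj S))`, whose Fourier–Borel transform is
`F̃(z) = conj (F (conj z))`. -/
def conjMeasure (μ : ComplexMeasure ℂ) : ComplexMeasure ℂ :=
  (μ.map conj).mapRange (starRingEnd ℂ).toAddMonoidHom Complex.continuous_conj

variable {X : Type*} [NormedAddCommGroup X] [NormedSpace ℂ X]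

/-- `(T(t))_{t ∈ S_α}` is an analytic semigroup of bounded operators on `X`. -/
structure IsAnalyticSemigroup (α : ℝ) (T : ℂ → X →L[ℂ] X) : Prop where
  map_add : ∀ s ∈ sector α, ∀ t ∈ sector α, T (s + t) = T s * T t
  analytic : DifferentiableOn ℂ T (sector α)

/-- A semigroup is quasinilpotent if all its elements have spectral radius zero. -/
def IsQuasinilpotentSemigroup (α : ℝ) (T : ℂ → X →L[ℂ] X) : Prop :=
  ∀ t ∈ sector α, spectralRadius ℂ (T t) = 0

/-- For `F` the Fourier–Borel transform of `μ`, the operator `F(-uA) = ∫ T(uξ) dμ(ξ)`, where `A`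
is the generator of `T`. -/
def functionalCalculus (T : ℂ → X →L[ℂ] X) (μ : ComplexMeasure ℂ) (u : ℂ) : X →L[ℂ] X :=
  pairing (fun ξ => T (u * ξ)) μ

/-- The Banach algebra `𝒜_T` generated by the semigroup: the closure, in operator norm, of the
(not necessarily unital) algebra generated by the operators `T(t)`, `t ∈ S_α`. -/
def semigroupAlgebra (α : ℝ) (T : ℂ → X →L[ℂ] X) : NonUnitalSubalgebra ℂ (X →L[ℂ] X) :=
  (NonUnitalAlgebra.adjoin ℂ (T '' sector α)).topologicalClosure

instance [CompleteSpace X] (α : ℝ) (T : ℂ → X →L[ℂ] X) :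
    CompleteSpace (semigroupAlgebra α T) :=
  (NonUnitalSubalgebra.isClosed_topologicalClosure _).completeSpace_coe

instance (α : ℝ) (T : ℂ → X →L[ℂ] X) : NormedSpace ℂ (semigroupAlgebra α T) where
  norm_smul_le c x := norm_smul_le c (x : X →L[ℂ] X)

open Classical in
/-- The element `T(t)` of `𝒜_T`, for `t ∈ S_α` (and `0` for other `t`). -/
def semigroupElement (α : ℝ) (T : ℂ → X →L[ℂ] X) (t : ℂ) : semigroupAlgebra α T :=
  if ht : t ∈ sector α then
    ⟨T t, subset_closure (NonUnitalAlgebra.subset_adjoin ℂ (Set.mem_image_of_mem T ht))⟩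
  else 0

/-- The image `π(T(t))` of `T(t)`, `t ∈ S_α`, in `𝒜_T / rad 𝒜_T`. -/
def quotientSemigroup (α : ℝ) (T : ℂ → X →L[ℂ] X) (t : ℂ) :
    RadQuotient (semigroupAlgebra α T) :=
  toRadQuotient (semigroupAlgebra α T) (semigroupElement α T t)

/-- The generator of `π(T(t))`, acting on `𝒜_T / rad 𝒜_T` by multiplication. -/
def quotientGenerator [CompleteSpace X] (α : ℝ) (T : ℂ → X →L[ℂ] X) :
    RadQuotient (semigroupAlgebra α T) →ₗ.[ℂ] RadQuotient (semigroupAlgebra α T) :=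
  generator fun t : ℝ => LinearMap.mulLeft ℂ (quotientSemigroup α T t)

end SectorSemigroup

end

noncomputable section

namespace SectorSemigroup

/-! ### Characters of commutative Banach algebras -/

section UnitalBanachAlgebra

open WeakDual Complex

variable {U : Type*} [NormedCommRing U] [NormedAlgebra ℂ U] [CompleteSpace U]

/-! The algebra `𝒜_T` is commutative, so an element killed by all characters lies in the radical,
and the claim reduces to bounding the exponents of characters. A nonzero character `χ` restricts on
the semigroup to `χ(T(s)) = e^{-ls}` for some `l : ℂ` (`eq_zero_or_exists_eq_exp`), hence sends
`F(-tA)` to `F(tl)`. With `G = F·F̃` and `M = sup |F|²` over the positive half-line, the hypothesis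
therefore gives `|G(tl)| < M` for `0 < t ≤ t₀`, since `|χ(a)|` is at most the spectral radius of
`a`.

These `l` stay bounded, for two reasons. The bound `|e^{-ls}| ≤ ‖T(s)‖` at two conjugate points `s`
of the sector confines `l` to a region `σ|Im l| ≤ Re l + C`. On a cone `|Im z| ≤ κ Re z` with `κσ >
1`, still narrow enough for `F` to decay there, a large `l` contradicts the maximum principle. Since
`|G(z̄)| = |G(z)|`, `|G| < M` on the two segments from `0` to `t₀l` and to its conjugate. On the arc
of radius `t₀|l|` joining them, `G` is small by decay; near `0` it is small because `F(0) = ∫ dμ =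
0`. Yet `|G|` takes the value `M` at a real point inside (`not_forall_norm_lt_on_segment`).

Once `|l| ≤ R`, for small `t₁` every nonzero character takes a value near `1` on `T(t₁)`.
Holomorphic functional calculus then gives `y` with `T(t₁)y` an identity modulo the radical
(`exists_inverse`), and the generator is multiplication by `π(T'(t₁)y)`. -/

theorem _root_.ContinuousLinearMap.circleIntegral_comp_comm {E F : Type*} [NormedAddCommGroup E]
    [NormedSpace ℂ E] [CompleteSpace E] [NormedAddCommGroup F] [NormedSpace ℂ F] [CompleteSpace F]
    (L : E →L[ℂ] F) {f : ℂ → E} {c : ℂ} {R : ℝ} (hf : CircleIntegrable f c R) :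
    (∮ z in C(c, R), L (f z)) = L (∮ z in C(c, R), f z) := by
  simp only [circleIntegral]
  rw [← L.intervalIntegral_comp_comm hf.out]
  simp

omit [CompleteSpace U] in
theorem character_resolvent (φ : characterSpace ℂ U) {x : U} {z : ℂ}
    (hz : z ∈ resolventSet ℂ x) : φ (resolvent x z) = (z - φ x)⁻¹ := by
  have h1 : (algebraMap ℂ U z - x) * resolvent x z = 1 := Ring.mul_inverse_cancel _ hz
  have h2 := congrArg φ h1
  rw [map_mul, map_sub, AlgHomClass.commutes, map_one] at h2
  exact (inv_eq_of_mul_eq_one_right h2).symm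

/-- If the spectrum of `x` lies in `{0} ∪ D(1, 1/4)`, then `x` has a partial inverse. -/
theorem exists_partial_inverse {x : U}
    (hx : ∀ φ : characterSpace ℂ U, φ x = 0 ∨ ‖φ x - 1‖ ≤ 1 / 4) :
    ∃ y : U, ∀ φ : characterSpace ℂ U,
      (φ x = 0 → φ y = 0) ∧ (φ x ≠ 0 → φ x * φ y = 1) := by
  have hres : ∀ z ∈ Metric.sphere (1 : ℂ) (1 / 2), z ∈ resolventSet ℂ x := by
    intro z hz
    by_contra hzs
    obtain ⟨φ, hφ⟩ := CharacterSpace.mem_spectrum_iff_exists.1 (show z ∈ spectrum ℂ x from hzs)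
    rw [mem_sphere_iff_norm] at hz
    rcases hx φ with h | h
    · rw [← hφ, h] at hz
      norm_num at hz
    · rw [hφ] at h
      linarith
  have hne : ∀ z ∈ Metric.closedBall (1 : ℂ) (1 / 2), z ≠ 0 := by
    rintro z hz rfl
    rw [mem_closedBall_iff_norm] at hz
    norm_num at hz
  have hinv : DiffContOnCl ℂ (fun z : ℂ => z⁻¹) (Metric.ball 1 (1 / 2)) := by
    apply DifferentiableOn.diffContOnCl_ball (U := {z | z ≠ 0}) _ hne
    exact fun z hz => (differentiableAt_inv hz).differentiableWithinAt
  have hint : CircleIntegrable (fun z => z⁻¹ • resolvent x z) 1 (1 / 2) := by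
    refine ContinuousOn.circleIntegrable (by norm_num) fun z hz => ?_
    refine ((continuousAt_inv₀ (hne z (Metric.sphere_subset_closedBall hz))).smul
      (spectrum.hasDerivAt_resolvent_const_left (hres z hz)).continuousAt).continuousWithinAt
  -- Functional calculus for the function equal to `1/z` near `1` and `0` near `0`: the circle
  -- separates the two parts of the spectrum. A character turns this into a Cauchy integral of
  -- `1/z`; when `φ x = 0` the integrand is `z⁻²`, holomorphic on the disc.
  refine ⟨(2 * Real.pi * I : ℂ)⁻¹ • ∮ z in C(1, 1 / 2), z⁻¹ • resolvent x z, fun φ => ?_⟩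
  have hφ : φ ((2 * Real.pi * I : ℂ)⁻¹ • ∮ z in C(1, 1 / 2), z⁻¹ • resolvent x z)
      = (2 * Real.pi * I : ℂ)⁻¹ * ∮ z in C(1, 1 / 2), (z - φ x)⁻¹ • z⁻¹ := by
    rw [map_smul, smul_eq_mul]
    congr 1
    rw [← CharacterSpace.coe_toCLM, ← ContinuousLinearMap.circleIntegral_comp_comm _ hint]
    refine circleIntegral.integral_congr (by norm_num) fun z hz => ?_
    simp only [CharacterSpace.coe_toCLM, map_smul, smul_eq_mul,
      character_resolvent φ (hres z hz), mul_comm]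
  rw [hφ]
  have h2 : (2 * Real.pi * I : ℂ) ≠ 0 := two_pi_I_ne_zero
  refine ⟨fun h0 => ?_, fun h0 => ?_⟩
  · rw [h0]
    have : DiffContOnCl ℂ (fun z : ℂ => (z - 0)⁻¹ • z⁻¹) (Metric.ball 1 (1 / 2)) := by
      simpa using hinv.smul hinv
    rw [this.circleIntegral_eq_zero (by norm_num), mul_zero]
  · have hb : φ x ∈ Metric.ball (1 : ℂ) (1 / 2) := by
      rw [mem_ball_iff_norm]
      rcases hx φ with h | h
      · exact absurd h h0
      · linarith
    rw [hinv.circleIntegral_sub_inv_smul hb, smul_eq_mul, inv_mul_cancel_left₀ h2,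
      mul_inv_cancel₀ h0]

/-- By Gelfand–Mazur, every maximal ideal is the kernel of a character. -/
theorem mem_of_isMaximal_of_forall_character {x : U} (hx : ∀ φ : characterSpace ℂ U, φ x = 0)
    (M : Ideal U) [hM : M.IsMaximal] : x ∈ M := by
  have hle : M ≤ RingHom.ker M.toCharacterSpace := fun a ha =>
    M.toCharacterSpace_apply_eq_zero_of_mem ha
  rw [hM.eq_of_le (Ideal.IsPrime.ne_top (RingHom.ker_isPrime _)) hle]
  exact hx _

end UnitalBanachAlgebra

section NonUnitalBanachAlgebra

open WeakDual

variable {A : Type*} [NonUnitalNormedRing A] [NormedSpace ℂ A] [IsScalarTower ℂ A A]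
  [SMulCommClass ℂ A A] [CompleteSpace A]

/-- The extension of a character of `A` to the unitization. -/
def unitizationCharacter (χ : A →ₙₐ[ℂ] ℂ) : WithLp 1 (Unitization ℂ A) →ₐ[ℂ] ℂ :=
  (Unitization.lift χ).comp
    (WithLp.unitizationAlgEquiv ℂ (𝕜 := ℂ) (A := A)).toAlgHom

omit [CompleteSpace A] in
theorem unitizationCharacter_inr (χ : A →ₙₐ[ℂ] ℂ) (a : A) :
    unitizationCharacter χ (WithLp.toLp 1 (a : Unitization ℂ A)) = χ a := by
  simp [unitizationCharacter]

/-- Automatic continuity, obtained by extending `χ` to the `ℓ¹` unitization, where algebra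
homomorphisms to `ℂ` are contractive. -/
theorem norm_character_le (χ : A →ₙₐ[ℂ] ℂ) (a : A) : ‖χ a‖ ≤ ‖a‖ := by
  have : NormOneClass (WithLp 1 (Unitization ℂ A)) :=
    ⟨by
      have h1 : WithLp.ofLp (1 : WithLp 1 (Unitization ℂ A)) = 1 := rfl
      rw [WithLp.unitization_norm_def, h1]
      simp⟩
  have h := AlgHom.norm_apply_le_self (unitizationCharacter χ)
    (WithLp.toLp 1 (a : Unitization ℂ A))
  rwa [unitizationCharacter_inr, WithLp.unitization_norm_inr] at h

/-- The unitization of a commutative Banach algebra, as a commutative Banach algebra. -/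
abbrev unitizationNormedCommRing (hcomm : ∀ a b : A, a * b = b * a) :
    NormedCommRing (WithLp 1 (Unitization ℂ A)) :=
  { (inferInstance : NormedRing (WithLp 1 (Unitization ℂ A))) with
    mul_comm := fun x y => by
      apply (WithLp.unitizationAlgEquiv ℂ (𝕜 := ℂ) (A := A)).injective
      rw [map_mul, map_mul]
      ext
      · simp [mul_comm]
      · simp [hcomm, add_comm] }

/-- The restriction to `A` of a character of the unitization. -/
def restrictCharacter (ψ : WithLp 1 (Unitization ℂ A) →ₐ[ℂ] ℂ) : A →ₙₐ[ℂ] ℂ :=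
  Unitization.lift.symm
    (ψ.comp (WithLp.unitizationAlgEquiv ℂ (𝕜 := ℂ) (A := A)).symm.toAlgHom)

/-- An element at which all characters vanish is in the radical. -/
theorem mem_radical_of_forall_character (hcomm : ∀ a b : A, a * b = b * a) {x : A}
    (hx : ∀ χ : A →ₙₐ[ℂ] ℂ, χ x = 0) : x ∈ radical A := by
  let _ := unitizationNormedCommRing hcomm
  let e : WithLp 1 (Unitization ℂ A) ≃+* Unitization ℂ A :=
    (WithLp.unitizationAlgEquiv ℂ (𝕜 := ℂ) (A := A)).toRingEquiv
  rw [mem_radical, Ring.jacobson_eq_sInf_isMaximal, Submodule.mem_sInf]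
  intro (I : Ideal (Unitization ℂ A)) hI
  have hI' : I.IsMaximal := hI
  have hmax : (I.comap e).IsMaximal := Ideal.comap_isMaximal_of_equiv e
  have hφ : ∀ φ : characterSpace ℂ (WithLp 1 (Unitization ℂ A)),
      φ (WithLp.toLp 1 (x : Unitization ℂ A)) = 0 := fun φ =>
    hx (restrictCharacter (CharacterSpace.toAlgHom φ))
  exact mem_of_isMaximal_of_forall_character hφ (I.comap e)

theorem exists_partial_inverse_of_forall_character (hcomm : ∀ a b : A, a * b = b * a) {x : A}
    (hx : ∀ χ : A →ₙₐ[ℂ] ℂ, χ x = 0 ∨ ‖χ x - 1‖ ≤ 1 / 4) :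
    ∃ y : A, ∀ χ : A →ₙₐ[ℂ] ℂ, χ x ≠ 0 → χ x * χ y = 1 := by
  let _ := unitizationNormedCommRing hcomm
  obtain ⟨y, hy⟩ := exists_partial_inverse (x := WithLp.toLp 1 (x : Unitization ℂ A))
    fun φ => hx (restrictCharacter (CharacterSpace.toAlgHom φ))
  -- The partial inverse found in the unitization already lies in `A`: the character with kernel `A`
  -- vanishes at `x`, hence at `y`.
  have hfst : (WithLp.ofLp y).fst = 0 := by
    refine (hy (CharacterSpace.equivAlgHom.symm ((Unitization.fstHom ℂ A).comp
      (WithLp.unitizationAlgEquiv ℂ (𝕜 := ℂ) (A := A)).toAlgHom))).1 ?_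
    exact Unitization.fst_inr ℂ x
  have hy' : y = WithLp.toLp 1 (((WithLp.ofLp y).snd : A) : Unitization ℂ A) := by
    apply WithLp.ofLp_injective
    ext
    · simpa using hfst
    · simp
  refine ⟨(WithLp.ofLp y).snd, fun χ hχ => ?_⟩
  have h := (hy (CharacterSpace.equivAlgHom.symm (unitizationCharacter χ))).2
  rw [hy'] at h
  simp only [CharacterSpace.equivAlgHom_symm_coe, unitizationCharacter_inr] at h
  exact h hχ

end NonUnitalBanachAlgebra

/-! ### Integration against complex measures -/

section ComplexMeasure

open VectorMeasure

instance isFiniteMeasure_variation {X : Type*} [MeasurableSpace X] (μ : ComplexMeasure X) :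
    IsFiniteMeasure μ.variation := by
  have h : μ.variation ≤ (ComplexMeasure.re μ).totalVariation
      + (ComplexMeasure.im μ).totalVariation := by
    refine variation_le_of_forall_enorm_le fun E _ => ?_
    have h1 : μ E = (((ComplexMeasure.re μ E : ℝ) : ℂ))
        + ((ComplexMeasure.im μ E : ℝ) : ℂ) * Complex.I := (Complex.re_add_im (μ E)).symm
    have h2 : ‖((ComplexMeasure.im μ E : ℝ) : ℂ) * Complex.I‖ₑ = ‖ComplexMeasure.im μ E‖ₑ := by
      rw [enorm_mul, ← ofReal_norm Complex.I, Complex.norm_I, ENNReal.ofReal_one, mul_one,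
        ← ofReal_norm, Complex.norm_real, ofReal_norm]
    have h3 : ‖((ComplexMeasure.re μ E : ℝ) : ℂ)‖ₑ = ‖ComplexMeasure.re μ E‖ₑ := by
      rw [← ofReal_norm, Complex.norm_real, ofReal_norm]
    rw [h1]
    refine (enorm_add_le _ _).trans ?_
    rw [h2, h3]
    exact add_le_add (SignedMeasure.enorm_le_totalVariation _ _)
      (SignedMeasure.enorm_le_totalVariation _ _)
  have : IsFiniteMeasure (ComplexMeasure.re μ).totalVariation := by
    unfold SignedMeasure.totalVariation; infer_instance
  have : IsFiniteMeasure (ComplexMeasure.im μ).totalVariation := by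
    unfold SignedMeasure.totalVariation; infer_instance
  exact isFiniteMeasure_of_le _ h

variable {μ : ComplexMeasure ℂ} {K : Set ℂ} {E F : Type*}
  [NormedAddCommGroup E] [NormedSpace ℂ E] [NormedAddCommGroup F] [NormedSpace ℂ F]

theorem ae_mem_of_forall_disjoint (hK : IsCompact K)
    (hμK : ∀ s, MeasurableSet s → Disjoint s K → μ s = 0) :
    ∀ᵐ ξ ∂μ.variation, ξ ∈ K := by
  rw [ae_iff]
  refine (variation_apply_eq_zero (s := Kᶜ) hK.measurableSet.compl).2 fun t ht htm => ?_
  exact hμK t htm (Set.disjoint_left.2 fun x hx hxK => ht hx hxK)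

omit [NormedSpace ℂ E] in
theorem integrable_variation_of_continuousOn (hK : IsCompact K)
    (hμK : ∀ s, MeasurableSet s → Disjoint s K → μ s = 0) {f : ℂ → E} (hf : ContinuousOn f K) :
    Integrable f μ.variation := by
  have h := hf.integrableOn_compact (μ := μ.variation) hK
  rwa [IntegrableOn, Measure.restrict_eq_self_of_ae_mem (ae_mem_of_forall_disjoint hK hμK)] at h

theorem pairing_congr (hK : IsCompact K)
    (hμK : ∀ s, MeasurableSet s → Disjoint s K → μ s = 0) {f g : ℂ → E}
    (h : ∀ ξ ∈ K, f ξ = g ξ) : pairing f μ = pairing g μ := by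
  refine integral_congr_ae ?_
  filter_upwards [ae_mem_of_forall_disjoint hK hμK] with ξ hξ using h ξ hξ

theorem map_pairing [CompleteSpace E] [CompleteSpace F] (L : E →L[ℂ] F) {f : ℂ → E}
    (hf : Integrable f μ.variation) : L (pairing f μ) = pairing (fun ξ => L (f ξ)) μ := by
  have h1 := continuousLinearMap_apply_integral (C := L.restrictScalars ℝ)
    (B := (ContinuousLinearMap.lsmul ℝ ℂ : ℂ →L[ℝ] E →L[ℝ] E).flip) hf
  have h2 := integral_continuousLinearMap_comp (C := L.restrictScalars ℝ)
    (B := (ContinuousLinearMap.lsmul ℝ ℂ : ℂ →L[ℝ] F →L[ℝ] F).flip) hf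
  refine h1.trans (Eq.trans ?_ h2.symm)
  congr 1
  ext x c
  simp

theorem exists_norm_pairing_le (hK : IsCompact K)
    (hμK : ∀ s, MeasurableSet s → Disjoint s K → μ s = 0) :
    ∃ C : ℝ, 0 ≤ C ∧ ∀ (f : ℂ → ℂ) (c : ℝ), (∀ ξ ∈ K, ‖f ξ‖ ≤ c) → ‖pairing f μ‖ ≤ C * c := by
  refine ⟨‖(ContinuousLinearMap.lsmul ℝ ℂ : ℂ →L[ℝ] ℂ →L[ℝ] ℂ).flip‖ * μ.variation.real Set.univ,
    by positivity, fun f c hf => ?_⟩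
  refine (VectorMeasure.norm_integral_le_of_norm_le_const (C := c) ?_).trans_eq (by ring)
  filter_upwards [ae_mem_of_forall_disjoint hK hμK] with ξ hξ using hf ξ hξ

theorem pairing_sub {f g : ℂ → E} (hf : Integrable f μ.variation) (hg : Integrable g μ.variation) :
    pairing (fun ξ => f ξ - g ξ) μ = pairing f μ - pairing g μ :=
  integral_fun_sub hf hg

theorem pairing_const_mul (c : ℂ) {f : ℂ → ℂ} (hf : Integrable f μ.variation) :
    pairing (fun ξ => c * f ξ) μ = c * pairing f μ :=
  (map_pairing (ContinuousLinearMap.mul ℂ ℂ c) hf).symm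

theorem measurable_conj : Measurable (conj : ℂ → ℂ) :=
  Complex.continuous_conj.measurable

theorem conjMeasure_apply (s : Set ℂ) (hs : MeasurableSet s) :
    conjMeasure μ s = conj (μ (conj ⁻¹' s)) := by
  rw [conjMeasure, mapRange_apply, map_apply _ measurable_conj hs]
  rfl

theorem conjMeasure_eq_zero_of_disjoint
    (hμK : ∀ s, MeasurableSet s → Disjoint s K → μ s = 0) (s : Set ℂ) (hs : MeasurableSet s)
    (hd : Disjoint s (conj '' K)) : conjMeasure μ s = 0 := by
  rw [conjMeasure_apply s hs, hμK _ (measurable_conj hs) ?_, _root_.map_zero]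
  rw [Set.disjoint_left] at hd ⊢
  exact fun x hx hxK => hd hx ⟨x, hxK, rfl⟩

theorem pairing_conjMeasure (hK : IsCompact K)
    (hμK : ∀ s, MeasurableSet s → Disjoint s K → μ s = 0) {f : ℂ → ℂ} (hf : Continuous f) :
    pairing f (conjMeasure μ) = conj (pairing (fun ξ => conj (f (conj ξ))) μ) := by
  have hcont : Continuous (fun ξ => f (conj ξ)) := hf.comp Complex.continuous_conj
  have hint : Integrable (fun ξ => f (conj ξ)) μ.variation :=
    integrable_variation_of_continuousOn hK hμK hcont.continuousOn
  have hvar : (conjMeasure μ).variation ≤ μ.variation.map conj := by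
    refine variation_le_of_forall_enorm_le fun s hs => ?_
    rw [conjMeasure_apply s hs, Measure.map_apply measurable_conj hs, ← ofReal_norm,
      RCLike.norm_conj, ofReal_norm]
    exact enorm_measure_le_variation _ _
  let B : ℂ →L[ℝ] ℂ →L[ℝ] ℂ := (ContinuousLinearMap.lsmul ℝ ℂ).flip
  let J : ℂ →L[ℝ] ℂ := Complex.conjCLE.toContinuousLinearMap
  -- Conjugation is only real linear, so it is absorbed into the bilinear map: `(x, c) ↦ conj (c *
  -- conj x)` against `μ`, after the change of variables `ξ ↦ conj ξ`.
  have h1 : pairing f (conjMeasure μ)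
      = μ.integral (fun ξ => f (conj ξ)) (ContinuousLinearMap.compL ℝ ℂ ℂ ℂ J ∘L (B ∘L J)) := by
    refine setToFun_of_le_map _ _ hint hf.aestronglyMeasurable measurable_conj hvar
      fun s x hs => ?_
    change conjMeasure μ s * x = conj (μ (conj ⁻¹' s) * conj x)
    rw [conjMeasure_apply s hs, map_mul, Complex.conj_conj]
  have hint2 : Integrable (fun ξ => J (f (conj ξ))) μ.variation :=
    integrable_variation_of_continuousOn hK hμK (J.continuous.comp hcont).continuousOn
  have h2 := continuousLinearMap_apply_integral (C := J) (B := B) hint2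
  have h3 := integral_continuousLinearMap_comp (C := J)
    (B := ContinuousLinearMap.compL ℝ ℂ ℂ ℂ J ∘L B) hint
  rw [h1]
  exact h3.symm.trans h2.symm

end ComplexMeasure

/-! ### The Fourier–Borel transform -/

section FourierBorel

variable {μ : ComplexMeasure ℂ} {K : Set ℂ}

theorem fourierBorel_conjMeasure (hK : IsCompact K)
    (hμK : ∀ s, MeasurableSet s → Disjoint s K → μ s = 0) (z : ℂ) :
    fourierBorel (conjMeasure μ) z = conj (fourierBorel μ (conj z)) := by
  rw [fourierBorel, pairing_conjMeasure hK hμK (by fun_prop), fourierBorel]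
  congr 2
  ext ξ
  rw [← Complex.exp_conj]
  simp

theorem fourierBorel_zero (hμ₀ : μ Set.univ = 0) : fourierBorel μ 0 = 0 := by
  have : fourierBorel μ 0 = pairing (fun _ => (1 : ℂ)) μ := by simp [fourierBorel]
  rw [this, pairing, VectorMeasure.integral_const]
  simp [hμ₀]

theorem norm_exp_sub_le {M : ℝ} {z ξ h : ℂ} (hξ : ‖ξ‖ ≤ M) (hh : ‖h‖ * M ≤ 1) :
    ‖Complex.exp (-(z + h) * ξ) - Complex.exp (-z * ξ) - h * (-ξ * Complex.exp (-z * ξ))‖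
      ≤ Real.exp (‖z‖ * M) * M ^ 2 * ‖h‖ ^ 2 := by
  have hM : 0 ≤ M := (norm_nonneg _).trans hξ
  have h1 : Complex.exp (-(z + h) * ξ) - Complex.exp (-z * ξ) - h * (-ξ * Complex.exp (-z * ξ))
      = Complex.exp (-z * ξ) * (Complex.exp (-h * ξ) - 1 - (-h * ξ)) := by
    rw [show -(z + h) * ξ = -z * ξ + -h * ξ by ring, Complex.exp_add]
    ring
  have h2 : ‖-h * ξ‖ ≤ ‖h‖ * M := by
    rw [norm_mul, norm_neg]
    gcongr
  have h3 : ‖Complex.exp (-z * ξ)‖ ≤ Real.exp (‖z‖ * M) := by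
    refine (Complex.norm_exp_le_exp_norm _).trans (Real.exp_le_exp.2 ?_)
    rw [norm_mul, norm_neg]
    gcongr
  rw [h1, norm_mul]
  calc _ ≤ Real.exp (‖z‖ * M) * ‖-h * ξ‖ ^ 2 :=
        mul_le_mul h3 (Complex.norm_exp_sub_one_sub_id_le (h2.trans hh)) (norm_nonneg _)
          (Real.exp_pos _).le
    _ ≤ Real.exp (‖z‖ * M) * (‖h‖ * M) ^ 2 := by gcongr
    _ = _ := by ring

theorem differentiable_fourierBorel (hK : IsCompact K)
    (hμK : ∀ s, MeasurableSet s → Disjoint s K → μ s = 0) :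
    Differentiable ℂ (fourierBorel μ) := by
  obtain ⟨C, hC, hbound⟩ := exists_norm_pairing_le hK hμK
  obtain ⟨M, hM⟩ := hK.isBounded.exists_norm_le
  have hint : ∀ {f : ℂ → ℂ}, Continuous f → Integrable f μ.variation := fun hf =>
    integrable_variation_of_continuousOn hK hμK hf.continuousOn
  intro z
  refine (HasDerivAt.differentiableAt (f' := pairing (fun ξ => -ξ * Complex.exp (-z * ξ)) μ) ?_)
  rw [hasDerivAt_iff_isLittleO_nhds_zero]
  refine Asymptotics.IsBigO.trans_isLittleO (g := fun h : ℂ => ‖h‖ ^ 2) ?_ ?_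
  · refine Asymptotics.IsBigO.of_bound (C * (Real.exp (‖z‖ * M) * M ^ 2)) ?_
    have hsmall : ∀ᶠ h : ℂ in 𝓝 0, ‖h‖ * M < 1 := by
      have : ContinuousAt (fun h : ℂ => ‖h‖ * M) 0 := by fun_prop
      refine this.tendsto.eventually_lt_const ?_
      simp
    filter_upwards [hsmall] with h hh
    have heq : fourierBorel μ (z + h) - fourierBorel μ z
          - h • pairing (fun ξ => -ξ * Complex.exp (-z * ξ)) μ
        = pairing (fun ξ => Complex.exp (-(z + h) * ξ) - Complex.exp (-z * ξ)
          - h * (-ξ * Complex.exp (-z * ξ))) μ := by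
      rw [pairing_sub (hint (by fun_prop)) (hint (by fun_prop)),
        pairing_sub (hint (by fun_prop)) (hint (by fun_prop)),
        pairing_const_mul h (hint (by fun_prop))]
      rfl
    rw [heq]
    refine (hbound _ _ fun ξ hξ => norm_exp_sub_le (hM ξ hξ) hh.le).trans_eq ?_
    rw [Real.norm_of_nonneg (by positivity)]
    ring
  · exact Asymptotics.isLittleO_norm_pow_id one_lt_two

/-- For `ξ ∈ K` and `z` in the cone, `Re (zξ) ≥ (1 - κτ) Re z Re ξ`, and `Re z ≥ ‖z‖ / (1 + κ)`; so
`e^{-zξ}` decays exponentially, uniformly on `K`. -/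
theorem norm_fourierBorel_lt_of_mem_cone (hK : IsCompact K)
    (hμK : ∀ s, MeasurableSet s → Disjoint s K → μ s = 0) {δ τ κ : ℝ} (hδ : 0 < δ)
    (hκ : 0 < κ) (hκτ : κ * τ < 1)
    (hKδ : ∀ ξ ∈ K, δ ≤ ξ.re ∧ |ξ.im| ≤ τ * ξ.re) {ε : ℝ} (hε : 0 < ε) :
    ∃ R : ℝ, ∀ z : ℂ, |z.im| ≤ κ * z.re → R ≤ ‖z‖ → ‖fourierBorel μ z‖ < ε := by
  obtain ⟨C, hC, hbound⟩ := exists_norm_pairing_le hK hμK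
  have hlim : Tendsto (fun r : ℝ => C * Real.exp (-(δ * (1 - κ * τ) * (r / (1 + κ)))))
      atTop (𝓝 0) := by
    rw [← mul_zero C]
    refine Tendsto.const_mul C (Real.tendsto_exp_neg_atTop_nhds_zero.comp ?_)
    refine Tendsto.const_mul_atTop (mul_pos hδ (by linarith)) ?_
    exact tendsto_id.atTop_div_const (by linarith)
  obtain ⟨R, hR⟩ := (eventually_atTop.1 (hlim.eventually_lt_const hε))
  refine ⟨R, fun z hz hRz => lt_of_le_of_lt (hbound _ _ fun ξ hξ => ?_) (hR _ hRz)⟩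
  obtain ⟨h1, h2⟩ := hKδ ξ hξ
  rw [Complex.norm_exp, Real.exp_le_exp]
  have hre : (-z * ξ).re = -(z.re * ξ.re - z.im * ξ.im) := by simp
  rw [hre]
  refine neg_le_neg ?_
  have hκz : 0 ≤ κ * z.re := (abs_nonneg _).trans hz
  have h0 : 0 ≤ z.re := nonneg_of_mul_nonneg_right hκz hκ
  have h3 := Complex.norm_le_abs_re_add_abs_im z
  rw [abs_of_nonneg h0] at h3
  have h4 : z.im * ξ.im ≤ (κ * z.re) * (τ * ξ.re) :=
    (le_abs_self _).trans ((abs_mul _ _).trans_le (mul_le_mul hz h2 (abs_nonneg _) hκz))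
  have h5 : ‖z‖ / (1 + κ) ≤ z.re := by
    rw [div_le_iff₀ (by linarith)]
    linarith
  calc δ * (1 - κ * τ) * (‖z‖ / (1 + κ)) ≤ ξ.re * (1 - κ * τ) * z.re := by
        have : 0 ≤ 1 - κ * τ := by linarith
        have : 0 ≤ ξ.re := by linarith
        gcongr
    _ ≤ _ := by nlinarith

end FourierBorel

/-! ### A maximum principle in cones -/

section MaximumPrinciple

open Complex

theorem exp_mem_cone {θ κ : ℝ} (hθ : θ ≤ Real.pi / 2) (hκ : 0 ≤ κ)
    (h : Real.sin θ ≤ κ * Real.cos θ) {w : ℂ} (hw : |w.im| ≤ θ) :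
    |(exp w).im| ≤ κ * (exp w).re := by
  have hpi := Real.pi_pos
  rw [exp_im, exp_re, abs_mul, abs_of_pos (Real.exp_pos _)]
  have h1 : |Real.sin w.im| ≤ Real.sin θ := by
    obtain ⟨h2, h3⟩ := abs_le.1 hw
    rw [abs_le, ← Real.sin_neg]
    exact ⟨Real.sin_le_sin_of_le_of_le_pi_div_two (by linarith) (by linarith) h2,
      Real.sin_le_sin_of_le_of_le_pi_div_two (by linarith) (by linarith) h3⟩
  have h2 : Real.cos θ ≤ Real.cos w.im := by
    rw [← Real.cos_abs w.im]
    exact Real.cos_le_cos_of_nonneg_of_le_pi (abs_nonneg _) (by linarith) hw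
  calc _ ≤ Real.exp w.re * (κ * Real.cos w.im) := by
        gcongr
        exact h1.trans (h.trans (by gcongr))
    _ = _ := by ring

/-- The maximum principle on a circular sector truncated near `0`, in the coordinate `w = log z`,
which makes it the rectangle `[a, b] × [-θ, θ]` with `θ = arg l`. -/
theorem not_forall_norm_lt_on_segment_of_im_pos {G : ℂ → ℂ} (hG : Differentiable ℂ G)
    (hsymm : ∀ z, ‖G (conj z)‖ = ‖G z‖) (hG₀ : G 0 = 0) {x₀ M κ R t₀ : ℝ} (hx₀ : 0 < x₀)
    (hM : 0 < M) (hGx₀ : ‖G x₀‖ = M) (hκ : 0 < κ)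
    (hdecay : ∀ z : ℂ, |z.im| ≤ κ * z.re → R ≤ ‖z‖ → ‖G z‖ < M) {l : ℂ} (hl : 0 < l.im)
    (hlκ : |l.im| ≤ κ * l.re) (hlR : R ≤ t₀ * ‖l‖) (hxR : x₀ < R)
    (hlt : ∀ t : ℝ, 0 < t → t ≤ t₀ → ‖G (t * l)‖ < M) : False := by
  have hpi := Real.pi_pos
  have hl0 : l ≠ 0 := by
    rintro rfl
    simp at hl
  have hnl : 0 < ‖l‖ := norm_pos_iff.2 hl0
  have hlre : 0 < l.re := by
    rw [abs_of_pos hl] at hlκ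
    exact pos_of_mul_pos_right (hl.trans_le hlκ) hκ.le
  set θ := arg l with hθ
  have hθpos : 0 < θ := by
    refine lt_of_le_of_ne (arg_nonneg_iff.2 hl.le) fun h => ?_
    have := arg_eq_zero_iff.1 (hθ.symm.trans h.symm)
    linarith [this.2]
  have hθpi : θ ≤ Real.pi / 2 := (le_abs_self _).trans (abs_arg_le_pi_div_two_iff.2 hlre.le)
  have hsc : Real.sin θ ≤ κ * Real.cos θ := by
    rw [hθ, sin_arg, cos_arg hl0, ← mul_div_assoc]
    gcongr
    exact (le_abs_self _).trans hlκ
  obtain ⟨r, hr, hr2⟩ : ∃ r > 0, ∀ z : ℂ, ‖z‖ < r → ‖G z‖ < M := by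
    have h1 : ContinuousAt (fun z => ‖G z‖) 0 := hG.continuous.norm.continuousAt
    have h2 : ∀ᶠ z in 𝓝 (0 : ℂ), ‖G z‖ < M := h1.tendsto.eventually_lt_const (by simpa [hG₀])
    obtain ⟨r, hr, h⟩ := Metric.eventually_nhds_iff.1 h2
    exact ⟨r, hr, fun z hz => h (by simpa using hz)⟩
  have hrx : r ≤ x₀ := by
    by_contra! h
    have := hr2 x₀ (by rwa [norm_real, Real.norm_of_nonneg hx₀.le])
    linarith
  have ha : Real.log (r / 2) < Real.log x₀ := Real.log_lt_log (by linarith) (by linarith)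
  have hb : Real.log x₀ < Real.log (t₀ * ‖l‖) := Real.log_lt_log hx₀ (by linarith)
  have hexpb : Real.exp (Real.log (t₀ * ‖l‖)) = t₀ * ‖l‖ := Real.exp_log (by linarith)
  have hexpa : Real.exp (Real.log (r / 2)) = r / 2 := Real.exp_log (by linarith)
  set a := Real.log (r / 2)
  set b := Real.log (t₀ * ‖l‖)
  set U : Set ℂ := Set.Ioo a b ×ℂ Set.Ioo (-θ) θ with hU
  have hclU : closure U = Set.Icc a b ×ℂ Set.Icc (-θ) θ := by
    rw [hU, closure_reProdIm, closure_Ioo (by linarith), closure_Ioo (by linarith)]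
  have hopen : IsOpen U := isOpen_Ioo.reProdIm isOpen_Ioo
  have hH : Differentiable ℂ (fun w => G (exp w)) := hG.comp differentiable_exp
  have htop : ∀ w : ℂ, w.re ≤ b → w.im = θ → ‖G (exp w)‖ < M := by
    intro w hwb hwθ
    have hw : exp w = ((Real.exp w.re / ‖l‖ : ℝ) : ℂ) * l := by
      have h1 := norm_mul_exp_arg_mul_I l
      rw [← hθ, ← hwθ] at h1
      have h2 : (‖l‖ : ℂ) ≠ 0 := by exact_mod_cast hnl.ne'
      calc exp w = exp w.re * exp (w.im * I) := by rw [← exp_add, re_add_im]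
        _ = ((Real.exp w.re / ‖l‖ : ℝ) : ℂ) * (‖l‖ * exp (w.im * I)) := by
          rw [ofReal_div, ofReal_exp, ← mul_assoc, div_mul_cancel₀ _ h2]
        _ = _ := by rw [h1]
    rw [hw]
    refine hlt _ (by positivity) ?_
    rw [div_le_iff₀ hnl, ← hexpb]
    exact Real.exp_le_exp.2 hwb
  -- Top edge: the segment through `l`. Bottom edge: its conjugate, by `hsymm`. Left edge: radius `r
  -- / 2`, where `G` is small. Right edge: radius `t₀ * ‖l‖ ≥ R`, inside the decay cone.
  have hfront : ∀ w ∈ frontier U, ‖G (exp w)‖ ≤ M := by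
    intro w hw
    rw [hU, frontier_reProdIm, closure_Ioo (by linarith), closure_Ioo (by linarith),
      frontier_Ioo (by linarith), frontier_Ioo (by linarith)] at hw
    rcases hw with ⟨h1, h2⟩ | ⟨h1, h2⟩
    · rcases h2 with h2 | h2
      · rw [← hsymm, ← exp_conj]
        exact (htop _ (by simpa using h1.2) (by rw [conj_im]; exact neg_eq_iff_eq_neg.2 h2)).le
      · exact (htop w h1.2 h2).le
    · rcases h1 with h1 | h1
      · refine (hr2 _ ?_).le
        rw [norm_exp, show w.re = a from h1, hexpa]
        linarith
      · refine (hdecay _ (exp_mem_cone hθpi hκ.le hsc (abs_le.2 h2)) ?_).le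
        rw [norm_exp, show w.re = b from h1, hexpb]
        exact hlR
  have hbdd : Bornology.IsBounded U := (Metric.isBounded_Ioo a b).reProdIm (Metric.isBounded_Ioo _ _)
  have hle : ∀ w ∈ closure U, ‖G (exp w)‖ ≤ M := fun w hw =>
    norm_le_of_forall_mem_frontier_norm_le hbdd hH.diffContOnCl hfront hw
  have hw0 : exp ((Real.log x₀ : ℝ) : ℂ) = x₀ := by
    rw [← ofReal_exp, Real.exp_log hx₀]
  have hmem : ((Real.log x₀ : ℝ) : ℂ) ∈ U := by
    refine ⟨?_, ?_⟩
    · simpa using ⟨ha, hb⟩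
    · simpa using hθpos
  have hconn : IsPreconnected U :=
    (((convex_Ioo a b).linear_preimage reLm).inter
      ((convex_Ioo (-θ) θ).linear_preimage imLm)).isPreconnected
  -- The maximum is attained at the interior point `log x₀`, so `‖G‖` is constantly `M`, which fails
  -- on the left edge.
  have heq := norm_eqOn_closure_of_isPreconnected_of_isMaxOn hconn hopen hH.diffContOnCl hmem
    (fun w hw => by
      simp only [Set.mem_ofPred_eq, Function.comp_apply, hw0, hGx₀]
      exact hle w (subset_closure hw))
  have ha' : (a : ℂ) ∈ closure U := by
    rw [hclU]
    refine ⟨?_, ?_⟩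
    · simpa using (ha.trans hb).le
    · simpa using hθpos.le
  have h1 := heq ha'
  simp only [Function.comp_apply, Function.const_apply, hw0, hGx₀] at h1
  have h2 := hr2 (exp a) (by rw [norm_exp, ofReal_re, hexpa]; linarith)
  linarith

theorem not_forall_norm_lt_on_segment {G : ℂ → ℂ} (hG : Differentiable ℂ G)
    (hsymm : ∀ z, ‖G (conj z)‖ = ‖G z‖) (hG₀ : G 0 = 0) {x₀ M κ R t₀ : ℝ} (hx₀ : 0 < x₀)
    (hM : 0 < M) (hGx₀ : ‖G x₀‖ = M) (hκ : 0 < κ)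
    (hdecay : ∀ z : ℂ, |z.im| ≤ κ * z.re → R ≤ ‖z‖ → ‖G z‖ < M) {l : ℂ}
    (hlκ : |l.im| ≤ κ * l.re) (hlR : R ≤ t₀ * ‖l‖)
    (hlt : ∀ t : ℝ, 0 < t → t ≤ t₀ → ‖G (t * l)‖ < M) : False := by
  have hxR : x₀ < R := by
    by_contra! h
    have := hdecay x₀ (by simpa using by positivity)
      (by rwa [norm_real, Real.norm_of_nonneg hx₀.le])
    linarith
  rcases lt_trichotomy l.im 0 with hl | hl | hl
  · refine not_forall_norm_lt_on_segment_of_im_pos hG hsymm hG₀ hx₀ hM hGx₀ hκ hdecay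
      (l := conj l) (by simpa using hl) (by simpa using hlκ) (by simpa using hlR) hxR
      fun t ht htt => ?_
    rw [← hsymm]
    simpa using hlt t ht htt
  -- For real `l` there is no sector, but the segment itself passes through `x₀`.
  · rw [hl, abs_zero] at hlκ
    have hre : 0 ≤ l.re := nonneg_of_mul_nonneg_right hlκ hκ
    have hll : l = (l.re : ℂ) := Complex.ext (by simp) (by simp [hl])
    have hn : ‖l‖ = l.re := by rw [hll, norm_real, Real.norm_of_nonneg hre, ofReal_re]
    rw [hn] at hlR
    have hre' : 0 < l.re := by
      refine lt_of_le_of_ne hre fun h => ?_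
      rw [← h] at hlR
      linarith
    have h := hlt (x₀ / l.re) (by positivity) (by rw [div_le_iff₀ hre']; linarith)
    have hx : ((x₀ / l.re : ℝ) : ℂ) * l = x₀ := by
      conv_lhs => rw [hll]
      rw [← ofReal_mul, ofReal_re, div_mul_cancel₀ _ hre'.ne']
    rw [hx] at h
    linarith
  · exact not_forall_norm_lt_on_segment_of_im_pos hG hsymm hG₀ hx₀ hM hGx₀ hκ hdecay hl hlκ hlR
      hxR hlt

theorem exists_norm_le_of_forall_norm_lt_on_segment {G : ℂ → ℂ} (hG : Differentiable ℂ G)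
    (hsymm : ∀ z, ‖G (conj z)‖ = ‖G z‖) (hG₀ : G 0 = 0) {x₀ M κ R t₀ σ C : ℝ} (hx₀ : 0 < x₀)
    (hM : 0 < M) (hGx₀ : ‖G x₀‖ = M) (hκ : 0 < κ) (ht₀ : 0 < t₀)
    (hdecay : ∀ z : ℂ, |z.im| ≤ κ * z.re → R ≤ ‖z‖ → ‖G z‖ < M) (hσ : 0 < σ) (hκσ : 1 < κ * σ) :
    ∃ R' : ℝ, ∀ l : ℂ, σ * |l.im| ≤ l.re + C →
      (∀ t : ℝ, 0 < t → t ≤ t₀ → ‖G (t * l)‖ < M) → ‖l‖ ≤ R' := by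
  set D := κ * |C| / (κ * σ - 1) with hD
  refine ⟨max (R / t₀) (D + (D / κ + |C|)), fun l hl hlt => ?_⟩
  by_contra! h
  obtain ⟨h1, h2⟩ := max_lt_iff.1 h
  have hc : 0 < κ * σ - 1 := by linarith
  by_cases hlκ : |l.im| ≤ κ * l.re
  · refine not_forall_norm_lt_on_segment hG hsymm hG₀ hx₀ hM hGx₀ hκ hdecay hlκ ?_ hlt
    rw [div_lt_iff₀ ht₀] at h1
    linarith
  · push Not at hlκ
    -- Outside the cone `κ Re l < |Im l|`; multiplying `hl` by `κ` gives `(κσ - 1)|Im l| ≤ κC`.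
    have h3 : |l.im| ≤ D := by
      rw [hD, le_div_iff₀ hc]
      nlinarith [mul_le_mul_of_nonneg_left hl hκ.le, mul_le_mul_of_nonneg_left (le_abs_self C) hκ.le]
    have h4 : |l.re| ≤ D / κ + |C| := by
      have h5 : 0 ≤ D / κ := by positivity
      rw [abs_le]
      constructor
      · have : 0 ≤ σ * |l.im| := by positivity
        linarith [le_abs_self C]
      · have : l.re ≤ D / κ := by
          rw [le_div_iff₀ hκ]
          linarith
        linarith [abs_nonneg C]
    linarith [norm_le_abs_re_add_abs_im l]

end MaximumPrinciple

/-! ### The sector -/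

section Sector

variable {α : ℝ}

theorem mem_sector_iff (hα₀ : 0 < α) (hα : α < Real.pi / 2) {z : ℂ} :
    z ∈ sector α ↔ |z.im| < Real.tan α * z.re := by
  have htan : 0 < Real.tan α := Real.tan_pos_of_pos_of_lt_pi_div_two hα₀ hα
  have key : 0 < z.re → (|z.arg| < α ↔ |z.im| < Real.tan α * z.re) := by
    intro hre
    have harg := abs_lt.1 (Complex.abs_arg_lt_pi_div_two_iff.2 (Or.inl hre))
    have hα' : α ∈ Set.Ioo (-(Real.pi / 2)) (Real.pi / 2) := ⟨by linarith, hα⟩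
    have hα'' : -α ∈ Set.Ioo (-(Real.pi / 2)) (Real.pi / 2) := ⟨by linarith, by linarith⟩
    rw [abs_lt, abs_lt, ← Real.strictMonoOn_tan.lt_iff_lt hα'' harg,
      ← Real.strictMonoOn_tan.lt_iff_lt harg hα', Real.tan_neg, Complex.tan_arg,
      lt_div_iff₀ hre, div_lt_iff₀ hre, neg_mul]
  constructor
  · rintro ⟨hre, harg⟩
    exact (key hre).1 harg
  · intro h
    have hre : 0 < z.re := pos_of_mul_pos_right ((abs_nonneg _).trans_lt h) htan.le
    exact ⟨hre, (key hre).2 h⟩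

theorem ofReal_mem_sector (hα₀ : 0 < α) {t : ℝ} (ht : 0 < t) : (t : ℂ) ∈ sector α := by
  refine ⟨by simpa, ?_⟩
  rw [Complex.arg_ofReal_of_nonneg ht.le, abs_zero]
  exact hα₀

theorem ofReal_mul_mem_sector {t : ℝ} (ht : 0 < t) {z : ℂ} (hz : z ∈ sector α) :
    (t : ℂ) * z ∈ sector α := by
  refine ⟨by simpa using mul_pos ht hz.1, ?_⟩
  rw [Complex.arg_real_mul _ ht]
  exact hz.2

theorem conj_mem_sector {z : ℂ} (hz : z ∈ sector α) : conj z ∈ sector α := by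
  refine ⟨by simpa using hz.1, ?_⟩
  rw [Complex.arg_conj]
  split_ifs with h
  · rw [← h]
    exact hz.2
  · rw [abs_neg]
    exact hz.2

theorem add_mem_sector (hα₀ : 0 < α) (hα : α < Real.pi / 2) {z w : ℂ} (hz : z ∈ sector α)
    (hw : w ∈ sector α) : z + w ∈ sector α := by
  rw [mem_sector_iff hα₀ hα] at *
  rw [Complex.add_im, Complex.add_re, mul_add]
  exact (abs_add_le _ _).trans_lt (add_lt_add hz hw)

theorem isOpen_sector (hα₀ : 0 < α) (hα : α < Real.pi / 2) : IsOpen (sector α) := by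
  have : sector α = {z | |z.im| < Real.tan α * z.re} := by
    ext z
    exact mem_sector_iff hα₀ hα
  rw [this]
  exact isOpen_lt (by fun_prop) (by fun_prop)

theorem convex_sector (hα₀ : 0 < α) (hα : α < Real.pi / 2) : Convex ℝ (sector α) := by
  refine convex_iff_forall_pos.2 fun x hx y hy a b ha hb _ => ?_
  rw [Complex.real_smul, Complex.real_smul]
  exact add_mem_sector hα₀ hα (ofReal_mul_mem_sector ha hx) (ofReal_mul_mem_sector hb hy)

theorem exists_bounds_of_isCompact_subset_sector (hα₀ : 0 < α) (hα : α < Real.pi / 2) {K : Set ℂ}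
    (hK : IsCompact K) (hKα : K ⊆ sector α) :
    ∃ δ τ : ℝ, 0 < δ ∧ 0 < τ ∧ τ < Real.tan α ∧
      ∀ ξ ∈ K, δ ≤ ξ.re ∧ |ξ.im| ≤ τ * ξ.re := by
  have htan : 0 < Real.tan α := Real.tan_pos_of_pos_of_lt_pi_div_two hα₀ hα
  rcases K.eq_empty_or_nonempty with rfl | hne
  · exact ⟨1, Real.tan α / 2, one_pos, by positivity, by linarith, by simp⟩
  obtain ⟨ξ₁, hξ₁, hmin⟩ := hK.exists_isMinOn hne Complex.continuous_re.continuousOn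
  have hcont : ContinuousOn (fun ξ : ℂ => |ξ.im| / ξ.re) K :=
    Complex.continuous_im.abs.continuousOn.div Complex.continuous_re.continuousOn
      fun ξ hξ => (hKα hξ).1.ne'
  obtain ⟨ξ₂, hξ₂, hmax⟩ := hK.exists_isMaxOn hne hcont
  refine ⟨ξ₁.re, max (|ξ₂.im| / ξ₂.re) (Real.tan α / 2), (hKα hξ₁).1,
    lt_max_of_lt_right (by positivity), max_lt ?_ (by linarith), fun ξ hξ => ⟨hmin hξ, ?_⟩⟩
  · rw [div_lt_iff₀ (hKα hξ₂).1]
    exact (mem_sector_iff hα₀ hα).1 (hKα hξ₂)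
  · rw [← div_le_iff₀ (hKα hξ).1]
    exact (hmax hξ).trans (le_max_left _ _)

/-- A scalar analytic semigroup on the sector is zero or an exponential. -/
theorem eq_zero_or_exists_eq_exp (hα₀ : 0 < α) (hα : α < Real.pi / 2) {f : ℂ → ℂ}
    (hf : DifferentiableOn ℂ f (sector α))
    (hadd : ∀ s ∈ sector α, ∀ t ∈ sector α, f (s + t) = f s * f t) :
    (∀ s ∈ sector α, f s = 0) ∨ ∃ l : ℂ, ∀ s ∈ sector α, f s = Complex.exp (-l * s) := by
  by_cases h0 : ∀ s ∈ sector α, f s = 0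
  · exact Or.inl h0
  refine Or.inr ?_
  push Not at h0
  obtain ⟨s₀, hs₀, hf₀⟩ := h0
  have hopen := isOpen_sector hα₀ hα
  have hd : ∀ s ∈ sector α, HasDerivAt f (deriv f s) s := fun s hs =>
    (hf.differentiableAt (hopen.mem_nhds hs)).hasDerivAt
  -- Differentiating `f (s₀ + s)` in either variable gives the same derivative, whence a linear
  -- differential equation for `f`.
  have hderiv : ∀ s ∈ sector α, f s₀ * deriv f s = deriv f s₀ * f s := by
    intro s hs
    have h1 : HasDerivAt (fun w => f (s₀ + w)) (deriv f (s₀ + s)) s :=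
      (hd _ (add_mem_sector hα₀ hα hs₀ hs)).comp_const_add s₀ s
    have h2 : HasDerivAt (fun w => f (w + s)) (deriv f (s₀ + s)) s₀ :=
      (hd _ (add_mem_sector hα₀ hα hs₀ hs)).comp_add_const s₀ s
    have h3 : HasDerivAt (fun w => f (s₀ + w)) (f s₀ * deriv f s) s := by
      refine ((hd s hs).const_mul (f s₀)).congr_of_eventuallyEq ?_
      filter_upwards [hopen.mem_nhds hs] with w hw using hadd s₀ hs₀ w hw
    have h4 : HasDerivAt (fun w => f (w + s)) (deriv f s₀ * f s) s₀ := by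
      refine ((hd s₀ hs₀).mul_const (f s)).congr_of_eventuallyEq ?_
      filter_upwards [hopen.mem_nhds hs₀] with w hw using hadd w hw s hs
    rw [h3.unique h1, h4.unique h2]
  set l := -(deriv f s₀ / f s₀) with hl
  have hexp : ∀ s, HasDerivAt (fun w => Complex.exp (l * w)) (Complex.exp (l * s) * l) s := by
    intro s
    simpa using ((hasDerivAt_id s).const_mul l).cexp
  have hg : ∀ s ∈ sector α, HasDerivAt (fun w => f w * Complex.exp (l * w)) 0 s := by
    intro s hs
    refine ((hd s hs).mul (hexp s)).congr_deriv ?_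
    have : deriv f s = -l * f s := by
      rw [hl, neg_neg, div_mul_eq_mul_div, ← hderiv s hs, mul_div_cancel_left₀ _ hf₀]
    rw [this]
    ring
  have hconst : ∀ s ∈ sector α, f s * Complex.exp (l * s) = f s₀ * Complex.exp (l * s₀) := by
    intro s hs
    exact hopen.is_const_of_deriv_eq_zero (convex_sector hα₀ hα).isPreconnected
      (fun s hs => (hg s hs).differentiableAt.differentiableWithinAt)
      (fun s hs => (hg s hs).deriv) hs hs₀
  set c := f s₀ * Complex.exp (l * s₀) with hc
  have hc0 : c ≠ 0 := mul_ne_zero hf₀ (Complex.exp_ne_zero _)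
  -- Evaluating the constant at `s₀ + s₀` makes it idempotent, so it is `1`.
  have hcc : c * c = c := by
    have h1 := hconst _ (add_mem_sector hα₀ hα hs₀ hs₀)
    rw [hadd s₀ hs₀ s₀ hs₀, mul_add, Complex.exp_add] at h1
    refine Eq.trans ?_ h1
    rw [hc]
    ring
  have hc1 : c = 1 := mul_left_cancel₀ hc0 (by rw [hcc, mul_one])
  refine ⟨l, fun s hs => ?_⟩
  have h1 := hconst s hs
  rw [hc1] at h1
  rw [neg_mul, Complex.exp_neg]
  exact eq_inv_of_mul_eq_one_left h1

end Sector

/-! ### Analytic semigroups in Banach algebras -/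

section AbstractSemigroup

variable {A : Type*} [NonUnitalNormedRing A] [NormedSpace ℂ A] [IsScalarTower ℂ A A]
  [SMulCommClass ℂ A A] {α : ℝ} {S : ℂ → A}

/-- `S` is an analytic semigroup on the sector which generates the Banach algebra `A`. -/
structure IsGeneratingSemigroup (α : ℝ) (S : ℂ → A) : Prop where
  map_add : ∀ s ∈ sector α, ∀ t ∈ sector α, S (s + t) = S s * S t
  exists_hasDerivAt : ∀ s ∈ sector α, ∃ d, HasDerivAt S d s
  dense : Dense (NonUnitalAlgebra.adjoin ℂ (S '' sector α) : Set A)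
  mul_comm : ∀ a b : A, a * b = b * a

variable [CompleteSpace A]

/-- A character as a continuous linear form. -/
def characterCLM (χ : A →ₙₐ[ℂ] ℂ) : A →L[ℂ] ℂ :=
  LinearMap.mkContinuous { toFun := χ, map_add' := map_add χ, map_smul' := map_smul χ } 1
    fun a => (norm_character_le χ a).trans_eq (one_mul _).symm

theorem characterCLM_apply (χ : A →ₙₐ[ℂ] ℂ) (a : A) : characterCLM χ a = χ a :=
  rfl

theorem IsGeneratingSemigroup.character_eq_zero (hS : IsGeneratingSemigroup α S) (χ : A →ₙₐ[ℂ] ℂ)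
    (hχ : ∀ s ∈ sector α, χ (S s) = 0) (a : A) : χ a = 0 := by
  have hclosed : IsClosed {b : A | characterCLM χ b = 0} :=
    isClosed_eq (characterCLM χ).continuous continuous_const
  refine closure_minimal (fun x hx => ?_) hclosed (hS.dense a)
  change χ x = 0
  induction hx using NonUnitalAlgebra.adjoin_induction with
  | mem x hx =>
    obtain ⟨s, hs, rfl⟩ := hx
    exact hχ s hs
  | add x y hx hy h1 h2 => rw [_root_.map_add, h1, h2, add_zero]
  | zero => exact map_zero χ
  | mul x y hx hy h1 h2 => rw [map_mul, h1, h2, mul_zero]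
  | smul r x hx h1 => rw [map_smul, h1, smul_zero]

theorem IsGeneratingSemigroup.character_apply (hS : IsGeneratingSemigroup α S) (hα₀ : 0 < α)
    (hα : α < Real.pi / 2) (χ : A →ₙₐ[ℂ] ℂ) :
    (∀ a, χ a = 0) ∨ ∃ l : ℂ, ∀ s ∈ sector α, χ (S s) = Complex.exp (-l * s) := by
  refine (eq_zero_or_exists_eq_exp hα₀ hα (f := fun s => χ (S s)) ?_ ?_).imp
    (hS.character_eq_zero χ) id
  · intro s hs
    obtain ⟨d, hd⟩ := hS.exists_hasDerivAt s hs
    exact ((characterCLM χ).hasFDerivAt.comp_hasDerivAt s hd).differentiableAt.differentiableWithinAt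
  · intro s hs t ht
    rw [hS.map_add s hs t ht, map_mul]

/-- Gelfand's formula, with `‖χ a‖ ^ n ≤ ‖ι a ^ n‖` for `n ≥ 1`. The spectral radius is that of the
ambient algebra, so `A` needs no unit. -/
theorem enorm_character_le_spectralRadius {B : Type*} [NormedRing B] [NormedAlgebra ℂ B]
    [CompleteSpace B] {ι : A → B} (hmul : ∀ a b, ι (a * b) = ι a * ι b) (hnorm : ∀ a, ‖ι a‖ = ‖a‖)
    (χ : A →ₙₐ[ℂ] ℂ) (a : A) : ‖χ a‖ₑ ≤ spectralRadius ℂ (ι a) := by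
  have hpow : ∀ n : ℕ, ∃ b : A, ι b = ι a ^ (n + 1) ∧ χ b = χ a ^ (n + 1) := by
    intro n
    induction n with
    | zero => exact ⟨a, by simp⟩
    | succ n ih =>
      obtain ⟨b, hb, hχb⟩ := ih
      exact ⟨b * a, by rw [hmul, hb, pow_succ (ι a) (n + 1)],
        by rw [map_mul, hχb, pow_succ (χ a) (n + 1)]⟩
  refine ge_of_tendsto (spectrum.pow_nnnorm_pow_one_div_tendsto_nhds_spectralRadius (ι a)) ?_
  filter_upwards [eventually_ge_atTop 1] with n hn
  obtain ⟨m, rfl⟩ : ∃ m, n = m + 1 := ⟨n - 1, by omega⟩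
  obtain ⟨b, hb, hχb⟩ := hpow m
  rw [← hb]
  have h1 : ‖χ a‖ₑ ^ (m + 1) ≤ ‖ι b‖ₑ := by
    rw [← enorm_pow, ← hχb, ← ofReal_norm, ← ofReal_norm, hnorm]
    exact ENNReal.ofReal_le_ofReal (norm_character_le χ b)
  calc ‖χ a‖ₑ = (‖χ a‖ₑ ^ (m + 1)) ^ (1 / ((m + 1 : ℕ) : ℝ)) := by
        rw [one_div, ENNReal.pow_rpow_inv_natCast (by omega)]
    _ ≤ _ := ENNReal.rpow_le_rpow h1 (by positivity)

omit [CompleteSpace A] in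
theorem IsGeneratingSemigroup.integrable (hS : IsGeneratingSemigroup α S) {μ : ComplexMeasure ℂ}
    {K : Set ℂ} (hK : IsCompact K) (hKα : K ⊆ sector α)
    (hμK : ∀ s, MeasurableSet s → Disjoint s K → μ s = 0) {t : ℝ} (ht : 0 < t) :
    Integrable (fun ξ : ℂ => S (t * ξ)) μ.variation := by
  refine integrable_variation_of_continuousOn hK hμK fun ξ hξ => ?_
  obtain ⟨d, hd⟩ := hS.exists_hasDerivAt _ (ofReal_mul_mem_sector ht (hKα hξ))
  exact (ContinuousAt.comp (f := fun ξ : ℂ => (t : ℂ) * ξ) hd.continuousAt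
    (continuous_const.mul continuous_id).continuousAt).continuousWithinAt

theorem IsGeneratingSemigroup.character_pairing (hS : IsGeneratingSemigroup α S)
    {μ : ComplexMeasure ℂ} {K : Set ℂ} (hK : IsCompact K) (hKα : K ⊆ sector α)
    (hμK : ∀ s, MeasurableSet s → Disjoint s K → μ s = 0) {t : ℝ} (ht : 0 < t)
    {χ : A →ₙₐ[ℂ] ℂ} {l : ℂ} (hχ : ∀ s ∈ sector α, χ (S s) = Complex.exp (-l * s)) :
    χ (pairing (fun ξ => S (t * ξ)) μ) = fourierBorel μ (t * l) := by
  rw [← characterCLM_apply, map_pairing _ (hS.integrable hK hKα hμK ht)]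
  refine pairing_congr hK hμK fun ξ hξ => ?_
  rw [characterCLM_apply, hχ _ (ofReal_mul_mem_sector ht (hKα hξ))]
  congr 1
  ring

theorem IsGeneratingSemigroup.exists_inverse (hS : IsGeneratingSemigroup α S)
    (hα₀ : 0 < α) (hα : α < Real.pi / 2) {R : ℝ}
    (hR : ∀ (χ : A →ₙₐ[ℂ] ℂ) (l : ℂ),
      (∀ s ∈ sector α, χ (S s) = Complex.exp (-l * s)) → ‖l‖ ≤ R) :
    ∃ t : ℝ, 0 < t ∧ ∃ y : A, ∀ a,
      toRadQuotient A (S t * y * a) = toRadQuotient A a := by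
  -- This makes `‖l * t₁‖ ≤ 1/8`, hence `‖exp (-l * t₁) - 1‖ ≤ 1/4`.
  set t₁ : ℝ := 1 / (8 * (|R| + 1)) with ht₁
  have ht₁pos : 0 < t₁ := by positivity
  set x := S t₁ with hx
  have hχx : ∀ χ : A →ₙₐ[ℂ] ℂ, (∀ a, χ a = 0) ∨ (χ x ≠ 0 ∧ ‖χ x - 1‖ ≤ 1 / 4) := by
    intro χ
    refine (hS.character_apply hα₀ hα χ).imp id ?_
    rintro ⟨l, hl⟩
    rw [hx, hl _ (ofReal_mem_sector hα₀ ht₁pos)]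
    refine ⟨Complex.exp_ne_zero _, ?_⟩
    have h1 : ‖-l * t₁‖ ≤ 1 / 8 := by
      rw [norm_mul, norm_neg, Complex.norm_real, Real.norm_of_nonneg ht₁pos.le, ht₁,
        mul_one_div, div_le_div_iff₀ (by positivity) (by norm_num)]
      linarith [hR χ l hl, le_abs_self R]
    linarith [Complex.norm_exp_sub_one_le (h1.trans (by norm_num))]
  obtain ⟨y, hy⟩ := exists_partial_inverse_of_forall_character hS.mul_comm (x := x)
    fun χ => (hχx χ).imp (fun h => h x) And.right
  refine ⟨t₁, ht₁pos, y, fun a => ?_⟩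
  rw [Submodule.mkQ_apply, Submodule.mkQ_apply, Submodule.Quotient.eq]
  refine mem_radical_of_forall_character hS.mul_comm fun χ => ?_
  rw [map_sub, map_mul, map_mul]
  rcases hχx χ with h | h
  · rw [h a, mul_zero, sub_zero]
  · rw [hy χ h.1, one_mul, sub_self]

/-- If the characters correspond to a bounded set of exponents, then the quotient by the radical
is unital and the generator is bounded. -/
theorem IsGeneratingSemigroup.isUnital_and_isBoundedOperator (hS : IsGeneratingSemigroup α S)
    (hα₀ : 0 < α) (hα : α < Real.pi / 2) {R : ℝ}
    (hR : ∀ (χ : A →ₙₐ[ℂ] ℂ) (l : ℂ),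
      (∀ s ∈ sector α, χ (S s) = Complex.exp (-l * s)) → ‖l‖ ≤ R) :
    IsUnital (RadQuotient A) ∧
      IsBoundedOperator (generator fun t : ℝ => LinearMap.mulLeft ℂ (toRadQuotient A (S t))) := by
  obtain ⟨t₁, ht₁pos, y, hid⟩ := hS.exists_inverse hα₀ hα hR
  have hsec : (t₁ : ℂ) ∈ sector α := ofReal_mem_sector hα₀ ht₁pos
  refine ⟨⟨toRadQuotient A (S t₁ * y), fun b => ?_⟩, ?_⟩
  · obtain ⟨a, rfl⟩ := Submodule.mkQ_surjective _ b
    rw [← toRadQuotient_mul, ← toRadQuotient_mul, hS.mul_comm a]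
    exact ⟨hid a, hid a⟩
  obtain ⟨d, hd⟩ := hS.exists_hasDerivAt _ hsec
  -- Modulo the radical, `a` is `S t₁ * y * a`, so the quotient `(S t * a - a) / t` becomes a
  -- difference quotient of `S` at `t₁`, times `y * a`. There `S` is differentiable in norm.
  have hlim : ∀ b : RadQuotient A,
      Tendsto (fun t : ℝ => t⁻¹ • (LinearMap.mulLeft ℂ (toRadQuotient A (S t)) b - b))
        (𝓝[>] 0) (𝓝 (toRadQuotient A (d * y) * b)) := by
    intro b
    obtain ⟨a, rfl⟩ := Submodule.mkQ_surjective _ b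
    have h1 : HasDerivAt (fun t : ℝ => S (t₁ + t)) d 0 := by
      have h2 : HasDerivAt (fun t : ℝ => (t₁ : ℂ) + t) 1 0 :=
        (Complex.ofRealCLM.hasDerivAt (x := 0)).const_add _
      have h3 : HasDerivAt S d ((t₁ : ℂ) + (0 : ℝ)) := by simpa using hd
      exact (h3.scomp (0 : ℝ) h2).congr_deriv (one_smul _ _)
    have h2 := (hasDerivAt_iff_tendsto_slope_zero.1 h1).mono_left
      (nhdsWithin_mono (0 : ℝ) fun t (ht : 0 < t) => ht.ne')
    let Φ : A →ₗ[ℂ] RadQuotient A := toRadQuotient A ∘ₗ LinearMap.mulRight ℂ (y * a)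
    have hΦ : Continuous Φ := continuous_quot_mk.comp (continuous_id.mul continuous_const)
    have h3 := (hΦ.tendsto d).comp h2
    have h4 : Φ d = toRadQuotient A (d * y) * toRadQuotient A a := by
      rw [← toRadQuotient_mul, mul_assoc]
      rfl
    rw [h4] at h3
    refine h3.congr' ?_
    filter_upwards [self_mem_nhdsWithin] with t (ht : 0 < t)
    have h5 : Φ (S t₁) = toRadQuotient A a := by
      rw [← hid a, mul_assoc]
      rfl
    have h6 : Φ (S (t₁ + t)) = toRadQuotient A (S t) * toRadQuotient A a := by
      rw [add_comm, hS.map_add _ (ofReal_mem_sector hα₀ ht) _ hsec, ← hid a, ← toRadQuotient_mul,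
        mul_assoc (S t₁), ← mul_assoc (S t)]
      rfl
    rw [Function.comp_apply, zero_add, Complex.ofReal_zero, add_zero, LinearMap.map_smul_of_tower,
      map_sub, h5, h6]
    rfl
  refine ⟨?_, ‖toRadQuotient A (d * y)‖, fun b => ?_⟩
  · rw [eq_top_iff]
    exact fun b _ => ⟨_, hlim b⟩
  · have : generator (fun t : ℝ => LinearMap.mulLeft ℂ (toRadQuotient A (S t))) b
        = toRadQuotient A (d * y) * b :=
      tendsto_nhds_unique b.2.choose_spec (hlim b)
    rw [this]
    exact norm_mul_le _ _

end AbstractSemigroup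

/-! ### The algebra generated by the semigroup -/

section SemigroupAlgebra

variable {X : Type*} [NormedAddCommGroup X] [NormedSpace ℂ X] {α : ℝ} {T : ℂ → X →L[ℂ] X}

theorem coe_semigroupElement {s : ℂ} (hs : s ∈ sector α) :
    (semigroupElement α T s : X →L[ℂ] X) = T s := by
  rw [semigroupElement, dif_pos hs]

/-- The inclusion of the algebra generated by the semigroup. -/
def semigroupAlgebraInclusion (α : ℝ) (T : ℂ → X →L[ℂ] X) :
    semigroupAlgebra α T →L[ℂ] (X →L[ℂ] X) where
  toFun := Subtype.val
  map_add' _ _ := rfl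
  map_smul' _ _ := rfl
  cont := continuous_subtype_val

theorem IsAnalyticSemigroup.semigroupElement_add (hT : IsAnalyticSemigroup α T) (hα₀ : 0 < α)
    (hα : α < Real.pi / 2) {s t : ℂ} (hs : s ∈ sector α) (ht : t ∈ sector α) :
    semigroupElement α T (s + t) = semigroupElement α T s * semigroupElement α T t := by
  apply Subtype.ext
  rw [coe_semigroupElement (add_mem_sector hα₀ hα hs ht)]
  refine (hT.map_add s hs t ht).trans ?_
  rw [← coe_semigroupElement (T := T) hs, ← coe_semigroupElement (T := T) ht]
  rfl

theorem IsAnalyticSemigroup.semigroupAlgebra_mul_comm (hT : IsAnalyticSemigroup α T)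
    (a b : semigroupAlgebra α T) : a * b = b * a := by
  have hcomm : ∀ a ∈ T '' sector α, ∀ b ∈ T '' sector α, a * b = b * a := by
    rintro _ ⟨s, hs, rfl⟩ _ ⟨t, ht, rfl⟩
    rw [← hT.map_add s hs t ht, ← hT.map_add t ht s hs, add_comm]
  have := NonUnitalAlgebra.isMulCommutative_adjoin ℂ hcomm
  exact ((NonUnitalAlgebra.adjoin ℂ (T '' sector α)).nonUnitalCommRingTopologicalClosure
    fun x y => IsMulCommutative.is_comm.comm x y).mul_comm a b

theorem IsAnalyticSemigroup.exists_hasDerivAt_semigroupElement (hT : IsAnalyticSemigroup α T)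
    (hα₀ : 0 < α) (hα : α < Real.pi / 2) {s : ℂ} (hs : s ∈ sector α) :
    ∃ d, HasDerivAt (semigroupElement α T) d s := by
  have hnhds := (isOpen_sector hα₀ hα).mem_nhds hs
  have hd : HasDerivAt (fun w => (semigroupElement α T w : X →L[ℂ] X)) (deriv T s) s := by
    refine (hT.analytic.differentiableAt hnhds).hasDerivAt.congr_of_eventuallyEq ?_
    filter_upwards [hnhds] with w hw using coe_semigroupElement hw
  have hmem : deriv T s ∈ semigroupAlgebra α T := by
    have hclosed : IsClosed (semigroupAlgebra α T : Set (X →L[ℂ] X)) :=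
      NonUnitalSubalgebra.isClosed_topologicalClosure _
    refine hclosed.mem_of_tendsto hd.tendsto_slope (Eventually.of_forall fun w => ?_)
    rw [slope_def_module]
    exact SMulMemClass.smul_mem _ (sub_mem (Subtype.coe_prop _) (Subtype.coe_prop _))
  refine ⟨⟨_, hmem⟩, ?_⟩
  rw [hasDerivAt_iff_isLittleO] at hd
  refine (hasDerivAt_iff_isLittleO (F := semigroupAlgebra α T)).2 ?_
  exact Asymptotics.IsLittleO.of_norm_left hd.norm_left

theorem dense_adjoin_semigroupElement :
    Dense (NonUnitalAlgebra.adjoin ℂ (semigroupElement α T '' sector α) :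
      Set (semigroupAlgebra α T)) := by
  have hsub : ∀ {x}, x ∈ NonUnitalAlgebra.adjoin ℂ (T '' sector α) → x ∈ semigroupAlgebra α T :=
    fun hx => subset_closure hx
  have key : (NonUnitalAlgebra.adjoin ℂ (T '' sector α) : Set (X →L[ℂ] X)) ⊆
      Subtype.val '' (NonUnitalAlgebra.adjoin ℂ (semigroupElement α T '' sector α) :
        Set (semigroupAlgebra α T)) := by
    intro x hx
    refine ⟨⟨x, hsub hx⟩, ?_, rfl⟩
    change (⟨x, hsub hx⟩ : semigroupAlgebra α T) ∈
      NonUnitalAlgebra.adjoin ℂ (semigroupElement α T '' sector α)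
    induction hx using NonUnitalAlgebra.adjoin_induction with
    | mem x hx =>
      obtain ⟨s, hs, rfl⟩ := hx
      exact NonUnitalAlgebra.subset_adjoin ℂ
        ⟨s, hs, Subtype.ext (coe_semigroupElement hs)⟩
    | add x y hx hy h1 h2 => exact add_mem h1 h2
    | zero => exact zero_mem _
    | mul x y hx hy h1 h2 => exact mul_mem h1 h2
    | smul r x hx h1 => exact SMulMemClass.smul_mem r h1
  intro a
  rw [Topology.IsInducing.subtypeVal.closure_eq_preimage_closure_image]
  exact closure_mono key a.2

theorem IsAnalyticSemigroup.isGeneratingSemigroup (hT : IsAnalyticSemigroup α T) (hα₀ : 0 < α)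
    (hα : α < Real.pi / 2) : IsGeneratingSemigroup α (semigroupElement α T) where
  map_add _ hs _ ht := hT.semigroupElement_add hα₀ hα hs ht
  exists_hasDerivAt _ hs := hT.exists_hasDerivAt_semigroupElement hα₀ hα hs
  dense := dense_adjoin_semigroupElement
  mul_comm := hT.semigroupAlgebra_mul_comm

theorem IsAnalyticSemigroup.coe_pairing [CompleteSpace X] (hT : IsAnalyticSemigroup α T)
    (hα₀ : 0 < α) (hα : α < Real.pi / 2) {μ : ComplexMeasure ℂ} {K : Set ℂ} (hK : IsCompact K)
    (hKα : K ⊆ sector α) (hμK : ∀ s, MeasurableSet s → Disjoint s K → μ s = 0) {t : ℝ}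
    (ht : 0 < t) :
    ((pairing (fun ξ => semigroupElement α T (t * ξ)) μ : semigroupAlgebra α T) : X →L[ℂ] X)
      = functionalCalculus T μ t := by
  refine (map_pairing (E := semigroupAlgebra α T) (semigroupAlgebraInclusion α T)
    ((hT.isGeneratingSemigroup hα₀ hα).integrable hK hKα hμK ht)).trans ?_
  exact pairing_congr hK hμK fun ξ hξ =>
    coe_semigroupElement (ofReal_mul_mem_sector ht (hKα hξ))

end SemigroupAlgebra

/-- The supremum is attained: `F` decays at infinity, and `F(0) = 0` keeps the maximum off the
endpoint. -/
theorem exists_isMaxOn_norm_fourierBorel {μ : ComplexMeasure ℂ} {K : Set ℂ} (hK : IsCompact K)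
    (hμK : ∀ s, MeasurableSet s → Disjoint s K → μ s = 0) (hμ₀ : μ Set.univ = 0)
    (hdecay : ∀ ε > 0, ∃ R : ℝ, ∀ x : ℝ, 0 < x → R ≤ x → ‖fourierBorel μ x‖ < ε)
    (hne : 0 < ⨆ (x : ℝ) (_ : 0 < x), ‖fourierBorel μ x‖ₑ ^ 2) :
    ∃ x₀ : ℝ, 0 < x₀ ∧ 0 < ‖fourierBorel μ x₀‖ ∧
      ∀ x : ℝ, 0 < x → ‖fourierBorel μ x‖ ≤ ‖fourierBorel μ x₀‖ := by
  obtain ⟨x₁, hx₁⟩ := lt_iSup_iff.1 hne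
  obtain ⟨hx₁pos, hx₁F⟩ := lt_iSup_iff.1 hx₁
  have hF₁ : 0 < ‖fourierBorel μ x₁‖ := by
    rw [norm_pos_iff]
    intro h
    simp [h] at hx₁F
  obtain ⟨R, hR⟩ := hdecay _ hF₁
  have hcont : Continuous (fun x : ℝ => ‖fourierBorel μ x‖) :=
    ((differentiable_fourierBorel hK hμK).continuous.comp Complex.continuous_ofReal).norm
  obtain ⟨x₀, hx₀, hmax⟩ := (isCompact_Icc (a := (0 : ℝ)) (b := max R x₁)).exists_isMaxOn
    ⟨x₁, hx₁pos.le, le_max_right _ _⟩ hcont.continuousOn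
  have h1 : ‖fourierBorel μ x₁‖ ≤ ‖fourierBorel μ x₀‖ := hmax ⟨hx₁pos.le, le_max_right _ _⟩
  refine ⟨x₀, lt_of_le_of_ne hx₀.1 ?_, hF₁.trans_le h1, fun x hx => ?_⟩
  · rintro rfl
    rw [Complex.ofReal_zero, fourierBorel_zero hμ₀, norm_zero] at h1
    linarith
  · rcases le_total x (max R x₁) with h | h
    · exact hmax ⟨hx.le, h⟩
    · exact (hR x hx ((le_max_left _ _).trans h)).le.trans h1

end SectorSemigroup

end

/-! ### Choice of the cones and conclusion -/

open SectorSemigroup in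
theorem mainTheorem6 {X : Type*} [NormedAddCommGroup X] [NormedSpace ℂ X] [CompleteSpace X]
    (α : ℝ) (hα₀ : 0 < α) (hα : α < Real.pi / 2)
    (μ : MeasureTheory.ComplexMeasure ℂ)
    (hμ : SectorSemigroup.IsCompactlySupportedIn μ (SectorSemigroup.sector α))
    (hμ₀ : μ Set.univ = 0)
    (T : ℂ → X →L[ℂ] X)
    (hT : SectorSemigroup.IsAnalyticSemigroup α T)
    (hqn : ¬ SectorSemigroup.IsQuasinilpotentSemigroup α T)
    (t₀ : ℝ) (ht₀ : 0 < t₀)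
    (hρ : ∀ t : ℝ, 0 < t → t ≤ t₀ →
      spectralRadius ℂ
          (SectorSemigroup.functionalCalculus T μ t *
            SectorSemigroup.functionalCalculus T (SectorSemigroup.conjMeasure μ) t) <
        ⨆ (x : ℝ) (_ : 0 < x), ‖SectorSemigroup.fourierBorel μ x‖ₑ ^ 2) :
    SectorSemigroup.IsUnital
        (SectorSemigroup.RadQuotient (SectorSemigroup.semigroupAlgebra α T)) ∧
      SectorSemigroup.IsBoundedOperator (SectorSemigroup.quotientGenerator α T) := by
  obtain ⟨K, hK, hKα, hμK⟩ := hμ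
  have hS := hT.isGeneratingSemigroup hα₀ hα
  have hK' : IsCompact (conj '' K) := hK.image Complex.continuous_conj
  have hKα' : conj '' K ⊆ sector α := by
    rintro _ ⟨ξ, hξ, rfl⟩
    exact conj_mem_sector (hKα hξ)
  have hμK' := conjMeasure_eq_zero_of_disjoint hμK
  obtain ⟨δ, τ, hδ, hτ, hτα, hKδ⟩ := exists_bounds_of_isCompact_subset_sector hα₀ hα hK hKα
  set σ := (τ + Real.tan α) / 2 with hσ
  have hτσ : τ < σ := by linarith
  have hσα : σ < Real.tan α := by linarith
  have hσ₀ : 0 < σ := by linarith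
  -- Any `κ` strictly between `1/σ` and `1/τ` would do: `κτ < 1` gives decay on the cone, `κσ > 1`
  -- bounds the exponents outside it.
  set κ := 2 / (τ + σ) with hκ
  have hκ₀ : 0 < κ := by positivity
  have hκτ : κ * τ < 1 := by
    rw [hκ, div_mul_eq_mul_div, div_lt_one (by positivity)]
    linarith
  have hκσ : 1 < κ * σ := by
    rw [hκ, div_mul_eq_mul_div, one_lt_div (by positivity)]
    linarith
  have hdecay := fun {ε : ℝ} (hε : 0 < ε) =>
    norm_fourierBorel_lt_of_mem_cone hK hμK hδ hκ₀ hκτ hKδ hε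
  obtain ⟨x₀, hx₀, hFx₀, hmax⟩ := exists_isMaxOn_norm_fourierBorel hK hμK hμ₀
    (fun ε hε => by
      obtain ⟨R, hR⟩ := hdecay hε
      refine ⟨R, fun x hx hRx => hR x ?_ ?_⟩
      · simpa using (mul_pos hκ₀ hx).le
      · rwa [Complex.norm_real, Real.norm_of_nonneg hx.le])
    -- The strict inequality at `t₀` forces the supremum to be positive.
    (pos_of_gt (hρ t₀ ht₀ le_rfl))
  set m := ‖fourierBorel μ x₀‖ with hm
  have hsup : ⨆ (x : ℝ) (_ : 0 < x), ‖fourierBorel μ x‖ₑ ^ 2 ≤ ENNReal.ofReal (m ^ 2) := by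
    refine iSup₂_le fun x hx => ?_
    rw [← ofReal_norm, ← ENNReal.ofReal_pow (norm_nonneg _)]
    exact ENNReal.ofReal_le_ofReal (pow_le_pow_left₀ (norm_nonneg _) (hmax x hx) 2)
  set G : ℂ → ℂ := fun z => fourierBorel μ z * fourierBorel (conjMeasure μ) z with hG
  have hGn : ∀ z, ‖G z‖ = ‖fourierBorel μ z‖ * ‖fourierBorel μ (conj z)‖ := by
    intro z
    rw [hG, norm_mul, fourierBorel_conjMeasure hK hμK, RCLike.norm_conj]
  obtain ⟨R, hR⟩ := hdecay hFx₀
  set s₁ : ℂ := 1 + σ * Complex.I with hs₁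
  have hs₁α : s₁ ∈ sector α := by
    rw [mem_sector_iff hα₀ hα]
    simpa [hs₁, abs_of_pos hσ₀] using hσα
  set C := max ‖semigroupElement α T s₁‖ ‖semigroupElement α T (conj s₁)‖ with hC
  obtain ⟨R', hR'⟩ := exists_norm_le_of_forall_norm_lt_on_segment (G := G) (t₀ := t₀) (C := C)
    ((differentiable_fourierBorel hK hμK).mul (differentiable_fourierBorel hK' hμK'))
    (fun z => by rw [hGn, hGn, Complex.conj_conj, mul_comm])
    (by simp [hG, fourierBorel_zero hμ₀]) hx₀ (pow_pos hFx₀ 2)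
    (by rw [hGn, Complex.conj_ofReal, ← hm, sq]) hκ₀ ht₀
    (fun z hz hRz => by
      rw [hGn, sq]
      exact mul_lt_mul'' (hR z hz hRz) (hR (conj z) (by simpa using hz) (by simpa using hRz))
        (norm_nonneg _) (norm_nonneg _)) hσ₀ hκσ
  refine hS.isUnital_and_isBoundedOperator hα₀ hα (R := R') fun χ l hχ => hR' l ?_ ?_
  -- From `1 - Re (ls) ≤ e^{-Re (ls)} ≤ C`; the points `1 ± iσ` then give the two signs of `Im l`.
  · have hle : ∀ s ∈ sector α, ‖semigroupElement α T s‖ ≤ C → -C ≤ (l * s).re := by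
      intro s hs hsC
      have h1 := (norm_character_le χ (semigroupElement α T s)).trans hsC
      rw [hχ s hs, Complex.norm_exp] at h1
      have h2 := Real.add_one_le_exp (-l * s).re
      have h3 : (-l * s).re = -(l * s).re := by rw [neg_mul, Complex.neg_re]
      linarith
    have h1 := hle s₁ hs₁α (le_max_left _ _)
    have h2 := hle (conj s₁) (conj_mem_sector hs₁α) (le_max_right _ _)
    have h3 : (l * s₁).re = l.re - σ * l.im := by simp [hs₁]; ring
    have h4 : (l * conj s₁).re = l.re + σ * l.im := by simp [hs₁]; ring
    rw [h3] at h1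
    rw [h4] at h2
    rcases abs_cases l.im with ⟨h, _⟩ | ⟨h, _⟩ <;> rw [h] <;> linarith
  · intro t ht htt
    set a : semigroupAlgebra α T := pairing (fun ξ => semigroupElement α T (t * ξ)) μ with ha
    set a' : semigroupAlgebra α T :=
      pairing (fun ξ => semigroupElement α T (t * ξ)) (conjMeasure μ) with ha'
    have h1 := enorm_character_le_spectralRadius (A := semigroupAlgebra α T)
      (ι := Subtype.val) (fun _ _ => rfl) (fun _ => rfl) χ (a * a')
    have h2 : ((a * a' : semigroupAlgebra α T) : X →L[ℂ] X)
        = functionalCalculus T μ t * functionalCalculus T (conjMeasure μ) t := by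
      rw [← hT.coe_pairing hα₀ hα hK hKα hμK ht, ← hT.coe_pairing hα₀ hα hK' hKα' hμK' ht]
      rfl
    have h3 : χ (a * a') = G (t * l) := by
      rw [map_mul, ha, ha', hS.character_pairing hK hKα hμK ht hχ,
        hS.character_pairing hK' hKα' hμK' ht hχ]
    rw [h2, h3] at h1
    have h4 := (h1.trans_lt (hρ t ht htt)).trans_le hsup
    rw [← ofReal_norm] at h4
    exact (ENNReal.ofReal_lt_ofReal_iff_of_nonneg (norm_nonneg _)).1 h4
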